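/- Let $1\le k<n$, where $k=k(n)$ may depend on $n$. In the planted clique model $G\sim G(n,1/2,k)$ on the vertex set $[n]$, a uniformly random set $K\subseteq[n]$ of size $k$ is chosen, all pairs of vertices in $K$ are connected, and every other pair of vertices is connected independently with probability $1/2$; $\mathbb P_1$ denotes the resulting probability. An algorithm making at most $q$ adaptive edge queries chooses successively at most $q$ pairs $(i,j)$, $1\le i<j\le n$, learning after each choice whether the pair is an edge of $G$; each choice may depend on the earlier answers, the output on all answers, and the computational power is unlimited. Logarithms are in base $2$. (a) Let $q=q(n)=o(n^2/k^2+n)$ as $n\to\infty$. Then every (possibly randomized) estimator $\widehat K$ of the planted clique $K$ that is based on at most $q$ adaptive edge queries satisfies $\mathbb P_1(\widehat K=K)=o(1)$ as $n\to\infty$. (b) Let $\varepsilon>0$ and $\varepsilon_0>0$ be constants, and suppose that $k\ge(2+\varepsilon)\log n$. There is a deterministic algorithm that always makes at most $$(2+\varepsilon_0)\frac{n^2}{k^2}\log^2 n+(1+\varepsilon_0)\,n\log n$$ edge queries, and whose output is equal to $K$ with probability $1-o(1)$ as $n\to\infty$. Moreover, the algorithm can be taken to make its queries in two rounds, as follows.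 In the first round it queries all pairs within a fixed set $S\subseteq[n]$, and finds a largest clique $D$ of the subgraph induced by $S$. It chooses a subset $D'\subseteq D$ of size $\min\{|D|,\lfloor(1+\varepsilon_0)\log n\rfloor\}$, depending only on the answers of the first round, and in the second round queries all pairs with one vertex in $D'$ and the other in $[n]\setminus S$. It outputs $D\cup T$, where $T$ is the set of the vertices in $[n]\setminus S$ that are adjacent to all vertices of $D'$. -/

import Mathlib

open Filter Topology Asymptotics MeasureTheory
open scoped ENNReal

namespace PlantedClique

/-- A pair `(i, j)` of vertices with `i < j`; these are the possible edge queries. -/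
abbrev VertexPair (n : ℕ) : Type := {e : Fin n × Fin n // e.1 < e.2}

open Classical in
/-- The answer of the graph `G` to the query `(i, j)`: is this pair an edge? -/
noncomputable def answer {n : ℕ} (G : SimpleGraph (Fin n)) (e : VertexPair n) : Bool :=
  decide (G.Adj e.1.1 e.1.2)

/-- Deterministic algorithms with unlimited computational power that adaptively make edge queries
to a graph with vertex set `Fin n` and then return an element of `β`: decision trees in which
every query is determined by the answers to the earlier queries, and the output by all answers. -/
inductive Algorithm (n : ℕ) (β : Type) : Type
  | output (b : β) : Algorithm n β
  | query (e : VertexPair n) (next : Bool → Algorithm n β) : Algorithm n β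

namespace Algorithm

/-- The output of the algorithm on the graph `G`. -/
noncomputable def run {n : ℕ} {β : Type} : Algorithm n β → SimpleGraph (Fin n) → β
  | output b, _ => b
  | query e next, G => run (next (answer G e)) G

/-- The list of the queries that the algorithm makes on the graph `G`, in order. -/
noncomputable def queries {n : ℕ} {β : Type} :
    Algorithm n β → SimpleGraph (Fin n) → List (VertexPair n)
  | output _, _ => []
  | query e next, G => e :: queries (next (answer G e)) G

/-- The number of queries that the algorithm makes on the graph `G`. -/
noncomputable def numQueries {n : ℕ} {β : Type} (A : Algorithm n β) (G : SimpleGraph (Fin n)) : ℕ :=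
  (A.queries G).length

/-- The algorithm makes its queries in two rounds: first the queries in the fixed list `L₁`, then
the queries in the list `L₂ a`, where `a` is the list of the answers to the first round. -/
def TwoRounds {n : ℕ} {β : Type} (A : Algorithm n β)
    (L₁ : List (VertexPair n)) (L₂ : List Bool → List (VertexPair n)) : Prop :=
  ∀ G : SimpleGraph (Fin n), A.queries G = L₁ ++ L₂ (L₁.map (answer G))

end Algorithm

/-- `D` is a largest clique of the subgraph of `G` induced by `S`. -/
def IsLargestCliqueIn {n : ℕ} (G : SimpleGraph (Fin n)) (S D : Finset (Fin n)) : Prop :=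
  D ⊆ S ∧ G.IsClique (D : Set (Fin n)) ∧
    ∀ C : Finset (Fin n), C ⊆ S → G.IsClique (C : Set (Fin n)) → C.card ≤ D.card

open Classical in
/-- `A` is a two-round algorithm of the following form. In the first round it queries all pairs
within a fixed set `S` of vertices. From the answers it computes a largest clique `D` in `S` and a
subset `D'` of `D` of size `s` (`D' = D` if `D` has at most `s` elements). In the second round
it queries all pairs with one vertex in `D'` and the other outside `S`. It outputs `D`
together with all vertices outside `S` that are adjacent to every vertex of `D'`. -/
def IsCliqueExtension {n : ℕ} (s : ℕ) (A : Algorithm n (Finset (Fin n))) : Prop :=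
  ∃ (S : Finset (Fin n)) (L₁ : List (VertexPair n)) (L₂ : List Bool → List (VertexPair n))
    (D D' : List Bool → Finset (Fin n)),
    A.TwoRounds L₁ L₂ ∧
    (∀ e : VertexPair n, e ∈ L₁ ↔ e.1.1 ∈ S ∧ e.1.2 ∈ S) ∧
    ∀ (G : SimpleGraph (Fin n)) (a : List Bool), a = L₁.map (answer G) →
      IsLargestCliqueIn G S (D a) ∧
      D' a ⊆ D a ∧ (D' a).card = min s (D a).card ∧
      (∀ e : VertexPair n, e ∈ L₂ a ↔
        (e.1.1 ∈ D' a ∧ e.1.2 ∉ S) ∨ (e.1.2 ∈ D' a ∧ e.1.1 ∉ S)) ∧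
      A.run G = D a ∪ Finset.univ.filter (fun v => v ∉ S ∧ ∀ u ∈ D' a, G.Adj u v)

/-- The graph obtained from `H` by connecting all pairs of vertices in `K`. -/
def plantClique {n : ℕ} (K : Finset (Fin n)) (H : SimpleGraph (Fin n)) : SimpleGraph (Fin n) :=
  H ⊔ SimpleGraph.fromRel (fun u v => u ∈ K ∧ v ∈ K)

/-- The planted clique model `G(n, 1/2, k)`, as the joint law of the planted clique and the graph:
the set `K` is uniform among the `k`-subsets of the vertices, independently of an Erdős–Rényi
graph with edge density `1/2`, in which all pairs of vertices in `K` are then connected. -/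
noncomputable def plantedCliqueModel (n k : ℕ) : Measure (Finset (Fin n) × SimpleGraph (Fin n)) :=
  ((ProbabilityTheory.uniformOn {K : Finset (Fin n) | K.card = k}).prod
    (SimpleGraph.binomialRandom (Fin n) ⟨1 / 2, by norm_num, by norm_num⟩)).map
      (fun x => (x.1, plantClique x.1 x.2))

/-- The probability, under `G(n, 1/2, k)`, that `A` outputs exactly the planted clique. -/
noncomputable def successProb {n : ℕ} (k : ℕ) (A : Algorithm n (Finset (Fin n))) : ℝ≥0∞ :=
  plantedCliqueModel n k {x | A.run x.2 = x.1}

/-- The probability that a randomized algorithm finds exactly the planted clique, over the graph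
and over its internal randomness, which is independent of the graph. A randomized algorithm is a
random deterministic algorithm (there are only countably many of these). -/
noncomputable def randomizedSuccessProb {n : ℕ} (k : ℕ)
    (R : PMF (Algorithm n (Finset (Fin n)))) : ℝ≥0∞ :=
  ∑' A, R A * successProb k A

end PlantedClique

/-!
**Lower bound.** The Erdős–Rényi graph `H` and the planted set `K` are independent, so it suffices
to bound, for each fixed `H`, the number of `k`-sets `K` that an algorithm finds in
`plantClique K H`. By averaging over its coins, a randomized algorithm is no better than the best
deterministic one (`randomizedSuccessProb_le`).
If `k² ≤ n`, then the queries that are made on `H` itself are a fixed list, a uniform `k`-set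
contains one of them with probability at most `q k² / n²`, and otherwise the output does not depend
on `K` (`card_run_eq_le_of_pairs`). If `k² > n`, the hypothesis on `q` amounts to `q = o(n)`. Once
`H` is fixed, an edge query is answered by two membership queries to `K`, so that the algorithm is
a decision tree of depth `d = 2 q` over membership queries. It identifies at most as many `k`-sets
as there are leaves with at most `k` positive answers, at most `(d + k).choose k`, and for
`k ≤ n / 2` this is a fraction of at most `2 (d + 1) / n` of all `k`-sets; for `k ≥ n / 2` negative
answers are counted instead (`IdentifiesFew`, `identifiesFew_run`, `choose_add_div_le`).

**Algorithm.** Let `S` consist of `m` vertices, where `m ≈ √(4 + 2 ε₀) n log₂ n / k`, so that the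
first round costs about `m² / 2 = (2 + ε₀) (n² / k²) log₂² n` queries. By Chebyshev's inequality for
the hypergeometric distribution (`uniformOn_card_inter_lt_le`), the planted part `B = K ∩ S` has
`ℓ ≥ (2 + δ) log₂ n` vertices with high probability. For fixed `K` with this property, a set of
`ℓ` vertices with `i ≥ 1` of them outside `B` is a clique with probability at most about
`2 ^ (-i ℓ / 2)`, and there are at most `(ℓ n) ^ i` such sets; as `ℓ n 2 ^ (-ℓ / 2)` is small, a
union bound shows that the largest clique in `S` is `B`
(`real_erdosRenyi_exists_pairsNotIn_le`). The set `D'` is chosen as a function of the clique that is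
found. When this clique is `B`, the set `D'` is therefore determined by `K`, and a vertex outside
`K` is adjacent to all of `D'` with probability at most `2 ^ (-#D')`, where `#D'` is at
least `(1 + η) log₂ n - 1` for some `η > 0` (`real_erdosRenyi_exists_adj_le`). No independence between
the two rounds is needed.
-/

namespace PlantedClique

open ProbabilityTheory

/-! ### The planted clique model -/

lemma plantClique_adj {n : ℕ} (K : Finset (Fin n)) (H : SimpleGraph (Fin n)) (u v : Fin n) :
    (plantClique K H).Adj u v ↔ H.Adj u v ∨ (u ≠ v ∧ u ∈ K ∧ v ∈ K) := by
  simp only [plantClique, SimpleGraph.sup_adj, SimpleGraph.fromRel_adj]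
  tauto

/-- Every set of graphs is measurable, the vertex set being finite. -/
instance measurableSingletonClass_simpleGraph (n : ℕ) :
    MeasurableSingletonClass (SimpleGraph (Fin n)) where
  measurableSet_singleton G := by
    have h := (measurableSet_singleton G.edgeSet).preimage
      (SimpleGraph.measurable_edgeSet (V := Fin n))
    convert h using 1
    ext H
    simp

open Classical in
lemma uniformOn_card_apply (n k : ℕ) (T : Set (Finset (Fin n))) :
    uniformOn {K : Finset (Fin n) | K.card = k} T =
      (((Finset.univ.powersetCard k).filter (· ∈ T)).card : ℝ≥0∞) / (n.choose k : ℝ≥0∞) := by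
  have h1 : {K : Finset (Fin n) | K.card = k} =
      ((Finset.univ.powersetCard k : Finset (Finset (Fin n))) : Set (Finset (Fin n))) := by
    ext K; simp [Finset.mem_powersetCard]
  have h2 : T = ((Finset.univ.filter (· ∈ T) : Finset (Finset (Fin n))) :
      Set (Finset (Fin n))) := by ext K; simp
  rw [h1]
  conv_lhs => rw [h2]
  rw [uniformOn_apply_finset, Finset.card_powersetCard, Finset.card_univ, Fintype.card_fin]
  congr 3
  ext K; simp

lemma isProbabilityMeasure_uniformOn_card {n k : ℕ} (hk : k ≤ n) :
    IsProbabilityMeasure (uniformOn {K : Finset (Fin n) | K.card = k}) := by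
  refine isProbabilityMeasure_uniformOn (Set.toFinite _) ?_
  obtain ⟨K, -, hK⟩ := Finset.exists_subset_card_eq
    (s := (Finset.univ : Finset (Fin n))) (n := k) (by simpa using hk)
  exact ⟨K, hK⟩

/-- The Erdős–Rényi graph with edge density `1/2`. -/
noncomputable abbrev erdosRenyi (n : ℕ) : Measure (SimpleGraph (Fin n)) :=
  SimpleGraph.binomialRandom (Fin n) ⟨1 / 2, by norm_num, by norm_num⟩

lemma plantedCliqueModel_apply (n k : ℕ) (T : Set (Finset (Fin n) × SimpleGraph (Fin n))) :
    plantedCliqueModel n k T =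
      ((uniformOn {K : Finset (Fin n) | K.card = k}).prod (erdosRenyi n))
        {x | (x.1, plantClique x.1 x.2) ∈ T} :=
  Measure.map_apply (measurable_of_countable _) (MeasurableSet.of_discrete)

lemma isProbabilityMeasure_plantedCliqueModel {n k : ℕ} (hk : k ≤ n) :
    IsProbabilityMeasure (plantedCliqueModel n k) := by
  have := isProbabilityMeasure_uniformOn_card hk
  exact Measure.isProbabilityMeasure_map (measurable_of_countable _).aemeasurable

open Classical in
/-- If, whatever the Erdős–Rényi graph, the algorithm is right for at most a proportion `c` of the
`k`-sets, then its success probability is at most `c`. -/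
lemma successProb_le {n k : ℕ} (A : Algorithm n (Finset (Fin n))) (c : ℝ≥0∞)
    (h : ∀ H : SimpleGraph (Fin n),
      (((Finset.univ.powersetCard k).filter
        (fun K => A.run (plantClique K H) = K)).card : ℝ≥0∞) / (n.choose k : ℝ≥0∞) ≤ c) :
    successProb k A ≤ c := by
  rw [successProb, plantedCliqueModel_apply, Measure.prod_apply_symm MeasurableSet.of_discrete]
  calc _ ≤ ∫⁻ _H, c ∂(erdosRenyi n) := by
        refine lintegral_mono fun H => ?_
        rw [uniformOn_card_apply]
        simpa using h H
    _ = c := by simp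

/-- If the algorithm fails with probability at most `r` for every planted set outside `B`, and
the planted set lies in `B` with probability at most `p`, then it succeeds with probability at
least `1 - (p + r)`. -/
lemma le_successProb {n k : ℕ} (hk : k ≤ n) (A : Algorithm n (Finset (Fin n)))
    (B : Set (Finset (Fin n))) (p r : ℝ≥0∞)
    (hB : uniformOn {K : Finset (Fin n) | K.card = k} B ≤ p)
    (h : ∀ K : Finset (Fin n), K.card = k → K ∉ B →
      erdosRenyi n {H | A.run (plantClique K H) ≠ K} ≤ r) :
    1 - (p + r) ≤ successProb k A := by
  have := isProbabilityMeasure_plantedCliqueModel hk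
  have := isProbabilityMeasure_uniformOn_card hk
  have hc : successProb k A = 1 - plantedCliqueModel n k {x | A.run x.2 ≠ x.1} := by
    rw [← prob_compl_eq_one_sub MeasurableSet.of_discrete]
    rw [successProb]
    congr 1
    ext x
    simp
  rw [hc]
  refine tsub_le_tsub_left ?_ _
  rw [plantedCliqueModel_apply, Measure.prod_apply MeasurableSet.of_discrete]
  have hae : ∀ᵐ K ∂(uniformOn {K : Finset (Fin n) | K.card = k}), K.card = k := by
    have := uniformOn_self (s := {K : Finset (Fin n) | K.card = k}) (Set.toFinite _)
      (by
        obtain ⟨K, -, hK⟩ := Finset.exists_subset_card_eq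
          (s := (Finset.univ : Finset (Fin n))) (n := k) (by simpa using hk)
        exact ⟨K, hK⟩)
    rw [← prob_compl_eq_zero_iff MeasurableSet.of_discrete] at this
    exact this
  calc _ ≤ ∫⁻ K, (B.indicator 1 K + r) ∂(uniformOn {K : Finset (Fin n) | K.card = k}) := by
        refine lintegral_mono_ae ?_
        filter_upwards [hae] with K hK
        by_cases hKB : K ∈ B
        · simp only [hKB, Set.indicator_of_mem, Pi.one_apply]
          exact prob_le_one.trans le_self_add
        · simpa [hKB] using h K hK hKB
    _ ≤ p + r := by
        rw [lintegral_add_right _ measurable_const, lintegral_indicator_one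
          MeasurableSet.of_discrete]
        simpa using add_le_add_left hB r

/-- A prescribed set of `m` pairs consists of edges of the Erdős–Rényi graph with probability at
most `2⁻ᵐ`. This includes sets with loops, for which the probability is `0`. -/
lemma erdosRenyi_edges_le (n : ℕ) (E : Finset (Sym2 (Fin n))) :
    erdosRenyi n {H | ∀ e ∈ E, e ∈ H.edgeSet} ≤ (2⁻¹ : ℝ≥0∞) ^ E.card := by
  rw [SimpleGraph.binomialRandom_apply', setBernoulli_apply]
  refine (measure_mono (t := Set.pi E (fun _ => {True})) ?_).trans ?_
  · rintro _ ⟨_, ⟨H, hH, rfl⟩, rfl⟩ e he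
    simpa using hH e he
  rw [Measure.infinitePi_pi _ (fun i _ => MeasurableSet.of_discrete)]
  rw [← Finset.prod_const]
  refine Finset.prod_le_prod' fun e _ => ?_
  have : (unitInterval.toNNReal ⟨1 / 2, by norm_num, by norm_num⟩ : ℝ≥0∞) = 2⁻¹ := by
    rw [show unitInterval.toNNReal ⟨1 / 2, by norm_num, by norm_num⟩ = (2⁻¹ : NNReal) from
      NNReal.eq (by rw [unitInterval.coe_toNNReal]; norm_num)]
    exact ENNReal.coe_inv_two
  have hfalse : Measure.dirac False ({True} : Set Prop) = 0 := by
    rw [Measure.dirac_apply, Set.indicator_of_notMem (by simp)]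
  rw [Measure.add_apply, Measure.smul_apply, Measure.smul_apply, hfalse, smul_zero, add_zero,
    Measure.dirac_apply, ENNReal.smul_def, this, smul_eq_mul]
  exact mul_le_of_le_one_right' (Set.indicator_le_self' (fun _ _ => zero_le) _)

/-! ### Uniform sets of given size -/

open Classical in
lemma card_powersetCard_mem {n k : ℕ} (hk : 1 ≤ k) (u : Fin n) :
    (((Finset.univ.powersetCard k).filter (fun K : Finset (Fin n) => u ∈ K)).card : ℝ) * n =
      n.choose k * k := by
  have h := Finset.card_filter_powersetCard_subset ({u} : Finset (Fin n))
    Finset.univ k (Finset.subset_univ _) (by simpa using hk)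
  simp only [Finset.singleton_subset_iff, Finset.card_univ, Fintype.card_fin,
    Finset.card_singleton] at h
  rw [h]
  have hn := u.pos
  obtain ⟨m, rfl⟩ : ∃ m, n = m + 1 := ⟨n - 1, by omega⟩
  obtain ⟨j, rfl⟩ : ∃ j, k = j + 1 := ⟨k - 1, by omega⟩
  have := Nat.add_one_mul_choose_eq m j
  rw [Nat.add_sub_cancel, Nat.add_sub_cancel, mul_comm]
  exact_mod_cast this

open Classical in
lemma card_powersetCard_mem_mem {n k : ℕ} (hk : 1 ≤ k) {u v : Fin n} (huv : u ≠ v) :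
    (((Finset.univ.powersetCard k).filter
      (fun K : Finset (Fin n) => u ∈ K ∧ v ∈ K)).card : ℝ) * (n * (n - 1)) =
      n.choose k * (k * (k - 1)) := by
  have hc : ({u, v} : Finset (Fin n)).card = 2 := Finset.card_pair huv
  have hsub : ∀ K : Finset (Fin n), {u, v} ⊆ K ↔ u ∈ K ∧ v ∈ K := fun K => by
    simp [Finset.insert_subset_iff]
  rcases hk.eq_or_lt with rfl | hk2
  · rw [Finset.filter_eq_empty_iff.mpr]
    · simp
    · intro K hK h
      have := Finset.card_le_card ((hsub K).mpr h)
      rw [hc, (Finset.mem_powersetCard.mp hK).2] at this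
      omega
  have h := Finset.card_filter_powersetCard_subset ({u, v} : Finset (Fin n))
    Finset.univ k (Finset.subset_univ _) (by omega)
  simp only [hsub, Finset.card_univ, Fintype.card_fin, hc] at h
  rw [h]
  have hn : 2 ≤ n := by
    have := Finset.card_le_univ ({u, v} : Finset (Fin n))
    rwa [hc, Fintype.card_fin] at this
  obtain ⟨m, rfl⟩ : ∃ m, n = m + 2 := ⟨n - 2, by omega⟩
  obtain ⟨j, rfl⟩ : ∃ j, k = j + 2 := ⟨k - 2, by omega⟩
  have h1 : ((m : ℝ) + 1) * m.choose j = (m + 1).choose (j + 1) * (j + 1) := by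
    exact_mod_cast Nat.add_one_mul_choose_eq m j
  have h2 : ((m : ℝ) + 1 + 1) * (m + 1).choose (j + 1) =
      (m + 2).choose (j + 2) * (j + 1 + 1) := by
    exact_mod_cast Nat.add_one_mul_choose_eq (m + 1) (j + 1)
  rw [Nat.add_sub_cancel, Nat.add_sub_cancel]
  push_cast
  linear_combination ((m : ℝ) + 2) * h1 + ((j : ℝ) + 1) * h2

open Classical in
lemma card_powersetCard_mem_mem_le {n k : ℕ} (hk : 1 ≤ k) (hkn : k ≤ n) {u v : Fin n}
    (huv : u ≠ v) :
    (((Finset.univ.powersetCard k).filter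
      (fun K : Finset (Fin n) => u ∈ K ∧ v ∈ K)).card : ℝ) ≤
      n.choose k * (k ^ 2 / n ^ 2) := by
  have h := card_powersetCard_mem_mem hk huv
  set N : ℝ := (((Finset.univ.powersetCard k).filter
      (fun K : Finset (Fin n) => u ∈ K ∧ v ∈ K)).card : ℝ)
  have hn : 2 ≤ n := by
    have := Finset.card_le_univ ({u, v} : Finset (Fin n))
    rwa [Finset.card_pair huv, Fintype.card_fin] at this
  have hn' : (2 : ℝ) ≤ n := by exact_mod_cast hn
  have hkn' : (k : ℝ) ≤ n := by exact_mod_cast hkn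
  rw [← mul_div_assoc, le_div_iff₀ (by positivity)]
  refine le_of_mul_le_mul_right (a := (n : ℝ) - 1) ?_ (by linarith)
  calc N * n ^ 2 * (n - 1) = (n.choose k * k) * (n * (k - 1)) := by linear_combination n * h
    _ ≤ (n.choose k * k) * (k * (n - 1)) := by
        refine mul_le_mul_of_nonneg_left ?_ (by positivity)
        linarith
    _ = _ := by ring

lemma le_choose {n k : ℕ} (hk : 1 ≤ k) (hkn : k < n) : n ≤ n.choose k := by
  induction n generalizing k with
  | zero => omega
  | succ n ih =>
    obtain ⟨j, rfl⟩ : ∃ j, k = j + 1 := ⟨k - 1, by omega⟩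
    rw [Nat.choose_succ_succ']
    rcases (show j + 1 ≤ n by omega).eq_or_lt with h | h
    · subst h
      simp
    · have := ih hk h
      have := Nat.choose_pos (show j ≤ n by omega)
      omega

/-! ### Few queries do not reach the clique -/

open Classical in
/-- Few queries rarely hit a uniform `k`-set: if planting `K` has changed the output, then one of
the queries made on `H` is a pair within `K`, and each pair lies in few `k`-sets. -/
lemma card_run_ne_le {n k : ℕ} (hk : 1 ≤ k) (hkn : k ≤ n)
    (A : Algorithm n (Finset (Fin n))) (H : SimpleGraph (Fin n)) :
    (((Finset.univ.powersetCard k).filter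
      (fun K => A.run (plantClique K H) ≠ A.run H)).card : ℝ) ≤
      A.numQueries H * (n.choose k * (k ^ 2 / n ^ 2)) := by
  induction A with
  | output b => simp [Algorithm.run, Algorithm.numQueries, Algorithm.queries]
  | query e next ih =>
    have hnum : (Algorithm.query e next).numQueries H =
        (next (answer H e)).numQueries H + 1 := by
      simp [Algorithm.numQueries, Algorithm.queries]
    rw [hnum, Nat.cast_succ, add_mul, one_mul]
    refine le_trans ?_ (add_le_add (ih (answer H e))
      (card_powersetCard_mem_mem_le hk hkn e.2.ne))
    rw [← Nat.cast_add]
    refine Nat.cast_le.mpr (le_trans (Finset.card_le_card ?_) (Finset.card_union_le _ _))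
    intro K hK
    rw [Finset.mem_filter, Algorithm.run, Algorithm.run] at hK
    obtain ⟨hK, hrun⟩ := hK
    rw [Finset.mem_union, Finset.mem_filter, Finset.mem_filter]
    by_cases hin : e.1.1 ∈ K ∧ e.1.2 ∈ K
    · exact Or.inr ⟨hK, hin⟩
    · left
      have : answer (plantClique K H) e = answer H e := by
        simp only [answer, plantClique_adj, decide_eq_decide]
        tauto
      rw [this] at hrun
      exact ⟨hK, hrun⟩

open Classical in
lemma card_run_eq_le_of_pairs {n k q : ℕ} (hk : 1 ≤ k) (hkn : k ≤ n)
    (A : Algorithm n (Finset (Fin n))) (H : SimpleGraph (Fin n)) (hq : A.numQueries H ≤ q) :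
    (((Finset.univ.powersetCard k).filter (fun K => A.run (plantClique K H) = K)).card : ℝ) ≤
      q * (n.choose k * (k ^ 2 / n ^ 2)) + 1 := by
  have h : (((Finset.univ.powersetCard k).filter
      (fun K => A.run (plantClique K H) = K)).card : ℝ) ≤
      ((Finset.univ.powersetCard k).filter
        (fun K => A.run (plantClique K H) ≠ A.run H)).card + 1 := by
    rw [← Nat.cast_add_one, Nat.cast_le, ← Finset.card_singleton (A.run H)]
    refine le_trans (Finset.card_le_card fun K => ?_) (Finset.card_union_le _ _)
    simp only [Finset.mem_filter, Finset.mem_union, Finset.mem_singleton]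
    rintro ⟨hK, hrun⟩
    by_cases h : A.run (plantClique K H) = A.run H
    · right; rw [← h, hrun]
    · left; exact ⟨hK, h⟩
  refine h.trans ?_
  gcongr
  refine (card_run_ne_le hk hkn A H).trans ?_
  gcongr

/-! ### Few queries do not reach most vertices -/

open Classical in
/-- `IdentifiesFew c d P`: the sets with property `P` can be told apart by `d` membership queries.
Precisely, among the sets with property `P` that agree on a set `V` of vertices and that have
(for `c = True`) at most `k` members outside `V`, or (for `c = False`) at most `k` nonmembers
outside `V`, there are at most `(d + k).choose k`, which bounds the number of leaves of a decision
tree of depth `d` that are reached with at most `k` answers `c`. -/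
def IdentifiesFew {n : ℕ} (c : Prop) (d : ℕ) (P : Finset (Fin n) → Prop) : Prop :=
  ∀ (V : Finset (Fin n)) (k : ℕ) (F : Finset (Finset (Fin n))),
    (∀ K ∈ F, P K) → (∀ K ∈ F, ∀ K' ∈ F, ∀ v ∈ V, (v ∈ K ↔ v ∈ K')) →
    (∀ K ∈ F, (Finset.univ.filter (fun v => v ∉ V ∧ (v ∈ K ↔ c))).card ≤ k) →
    F.card ≤ (d + k).choose k

lemma IdentifiesFew.mono {n : ℕ} {c : Prop} {d d' : ℕ} {P P' : Finset (Fin n) → Prop}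
    (h : IdentifiesFew c d P) (hd : d ≤ d') (hP : ∀ K, P' K → P K) : IdentifiesFew c d' P' :=
  fun V k F hF hV hk =>
    (h V k F (fun K hK => hP K (hF K hK)) hV hk).trans (Nat.choose_le_choose k (by omega))

lemma identifiesFew_eq {n : ℕ} (c : Prop) (d : ℕ) (b : Finset (Fin n)) :
    IdentifiesFew c d (fun K => b = K) := by
  intro V k F hF _ _
  have : F ⊆ {b} := fun K hK => by simp [hF K hK]
  exact (Finset.card_le_card this).trans (Nat.choose_pos (by omega))

open Classical in
/-- One membership query, whether `v` belongs to the set: Pascal's rule. -/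
lemma IdentifiesFew.split {n : ℕ} {c : Prop} {d : ℕ} {P : Finset (Fin n) → Prop} (v : Fin n)
    (h₁ : IdentifiesFew c d (fun K => P K ∧ v ∈ K))
    (h₂ : IdentifiesFew c d (fun K => P K ∧ v ∉ K)) : IdentifiesFew c (d + 1) P := by
  have hc₁ : IdentifiesFew c d (fun K => P K ∧ (v ∈ K ↔ c)) := by
    by_cases hc : c
    · exact h₁.mono le_rfl (fun K hK => ⟨hK.1, hK.2.mpr hc⟩)
    · exact h₂.mono le_rfl (fun K hK => ⟨hK.1, fun h => hc (hK.2.mp h)⟩)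
  have hc₂ : IdentifiesFew c d (fun K => P K ∧ ¬ (v ∈ K ↔ c)) := by
    by_cases hc : c
    · exact h₂.mono le_rfl (fun K hK => ⟨hK.1, fun h => hK.2 (by tauto)⟩)
    · exact h₁.mono le_rfl (fun K hK => ⟨hK.1, by tauto⟩)
  intro V k F hF hV hk
  by_cases hvV : v ∈ V
  · by_cases hex : ∃ K ∈ F, (v ∈ K ↔ c)
    · obtain ⟨K₀, hK₀, hvK₀⟩ := hex
      refine (hc₁ V k F (fun K hK => ⟨hF K hK, ?_⟩) hV hk).trans
        (Nat.choose_le_choose k (by omega))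
      rw [hV K hK K₀ hK₀ v hvV]; exact hvK₀
    · refine (hc₂ V k F (fun K hK => ⟨hF K hK, ?_⟩) hV hk).trans
        (Nat.choose_le_choose k (by omega))
      exact fun h => hex ⟨K, hK, h⟩
  have hagree : ∀ (p : Prop) (F' : Finset (Finset (Fin n))), F' ⊆ F →
      (∀ K ∈ F', ((v ∈ K ↔ c) ↔ p)) →
      ∀ K ∈ F', ∀ K' ∈ F', ∀ w ∈ insert v V, (w ∈ K ↔ w ∈ K') := by
    intro p F' hF' hp K hK K' hK' w hw
    rcases Finset.mem_insert.mp hw with rfl | hw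
    · have := hp K hK; have := hp K' hK'; tauto
    · exact hV K (hF' hK) K' (hF' hK') w hw
  have hfalse : (F.filter (fun K => ¬ (v ∈ K ↔ c))).card ≤ (d + k).choose k := by
    refine hc₂ (insert v V) k _ (fun K hK => ?_)
      (hagree False _ (Finset.filter_subset _ _) (fun K hK => ?_)) (fun K hK => ?_)
    · exact ⟨hF K (Finset.mem_filter.mp hK).1, (Finset.mem_filter.mp hK).2⟩
    · simpa using (Finset.mem_filter.mp hK).2
    · refine le_trans (Finset.card_le_card fun w => ?_) (hk K (Finset.mem_filter.mp hK).1)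
      simp only [Finset.mem_filter, Finset.mem_insert]
      tauto
  have hlt : ∀ K ∈ F.filter (fun K => (v ∈ K ↔ c)),
      (Finset.univ.filter (fun w => w ∉ insert v V ∧ (w ∈ K ↔ c))).card < k := by
    intro K hK
    refine lt_of_lt_of_le (Finset.card_lt_card ?_) (hk K (Finset.mem_filter.mp hK).1)
    refine (Finset.ssubset_iff_of_subset fun w => ?_).mpr ⟨v, ?_, ?_⟩
    · simp only [Finset.mem_filter, Finset.mem_insert]
      tauto
    · simpa [hvV] using (Finset.mem_filter.mp hK).2
    · simp
  have htrue : (F.filter (fun K => (v ∈ K ↔ c))).card ≤ (d + k).choose (k - 1) := by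
    rcases Nat.eq_zero_or_pos k with rfl | hkpos
    · rw [Finset.eq_empty_of_forall_notMem (s := F.filter _)
        (fun K hK => absurd (hlt K hK) (by omega))]
      simp
    refine (hc₁ (insert v V) (k - 1) _ (fun K hK => ?_)
      (hagree True _ (Finset.filter_subset _ _) (fun K hK => ?_)) (fun K hK => ?_)).trans
      (Nat.choose_le_choose (k - 1) (by omega))
    · exact ⟨hF K (Finset.mem_filter.mp hK).1, (Finset.mem_filter.mp hK).2⟩
    · simpa using (Finset.mem_filter.mp hK).2
    · have := hlt K hK
      omega
  rcases Nat.eq_zero_or_pos k with rfl | hkpos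
  · rw [Finset.eq_empty_of_forall_notMem (s := F.filter (fun K => (v ∈ K ↔ c)))
        (fun K hK => absurd (hlt K hK) (by omega)), Finset.card_empty] at htrue
    have hall : F.filter (fun K => ¬ (v ∈ K ↔ c)) = F := by
      refine Finset.filter_true_of_mem fun K hK h => ?_
      exact absurd (hlt K (Finset.mem_filter.mpr ⟨hK, h⟩)) (by omega)
    rw [hall] at hfalse
    simpa using hfalse
  · obtain ⟨j, rfl⟩ := Nat.exists_eq_succ_of_ne_zero hkpos.ne'
    rw [← Finset.card_filter_add_card_filter_not (s := F) (fun K => (v ∈ K ↔ c))]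
    have : (d + 1 + (j + 1)).choose (j + 1) = (d + (j + 1)).choose j +
        (d + (j + 1)).choose (j + 1) := by
      rw [show d + 1 + (j + 1) = (d + (j + 1)) + 1 by ring, Nat.choose_succ_succ]
    rw [Nat.succ_eq_add_one] at *
    rw [this]
    simpa using add_le_add htrue hfalse

/-- The answer to an edge query in `plantClique K H` is determined by two membership queries to
`K`. -/
lemma identifiesFew_run {n : ℕ} (c : Prop) (H : SimpleGraph (Fin n))
    (A : Algorithm n (Finset (Fin n))) (q : ℕ) :
    IdentifiesFew c (2 * q) (fun K => A.run (plantClique K H) = K ∧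
      A.numQueries (plantClique K H) ≤ q) := by
  induction A generalizing q with
  | output b => exact (identifiesFew_eq c (2 * q) b).mono le_rfl (fun K hK => hK.1)
  | query e next ih =>
    have hnum : ∀ G, (Algorithm.query e next).numQueries G =
        (next (answer G e)).numQueries G + 1 := fun G => by
      simp [Algorithm.numQueries, Algorithm.queries]
    have hne : e.1.1 ≠ e.1.2 := e.2.ne
    rcases q with _ | q
    · intro V k F hF _ _
      rw [Finset.eq_empty_of_forall_notMem (s := F) fun K hK => by
        have := (hF K hK).2
        rw [hnum] at this
        omega]
      simp
    have hleaf : ∀ (b : Bool) (P : Finset (Fin n) → Prop), (∀ K, P K →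
        ((Algorithm.query e next).run (plantClique K H) = K ∧
          (Algorithm.query e next).numQueries (plantClique K H) ≤ q + 1) ∧
        answer (plantClique K H) e = b) → IdentifiesFew c (2 * q) P := by
      intro b P hP
      refine (ih b q).mono le_rfl fun K hK => ?_
      obtain ⟨⟨h1, h2⟩, h3⟩ := hP K hK
      rw [hnum, h3] at h2
      rw [Algorithm.run, h3] at h1
      exact ⟨h1, by omega⟩
    have hout : ∀ K, ¬ (e.1.1 ∈ K ∧ e.1.2 ∈ K) → answer (plantClique K H) e = answer H e := by
      intro K hK
      simp only [answer, plantClique_adj, decide_eq_decide]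
      tauto
    rw [show 2 * (q + 1) = 2 * q + 1 + 1 by ring]
    refine IdentifiesFew.split e.1.1 (IdentifiesFew.split e.1.2 ?_ ?_) ?_
    · refine hleaf true _ fun K hK => ⟨hK.1.1, ?_⟩
      simp only [answer, plantClique_adj, decide_eq_true_eq]
      exact Or.inr ⟨hne, hK.1.2, hK.2⟩
    · exact hleaf (answer H e) _ fun K hK => ⟨hK.1.1, hout K fun h => hK.2 h.2⟩
    · exact (hleaf (answer H e) _ fun K hK => ⟨hK.1, hout K fun h => hK.2 h.1⟩).mono
        (Nat.le_succ _) (fun _ h => h)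

open Classical in
lemma card_run_eq_le_choose {n k q : ℕ} (A : Algorithm n (Finset (Fin n)))
    (H : SimpleGraph (Fin n)) (hq : ∀ G, A.numQueries G ≤ q) :
    ((Finset.univ.powersetCard k).filter (fun K => A.run (plantClique K H) = K)).card ≤
      (2 * q + k).choose k ∧
    ((Finset.univ.powersetCard k).filter (fun K => A.run (plantClique K H) = K)).card ≤
      (2 * q + (n - k)).choose (n - k) := by
  have hmem : ∀ K ∈ ((Finset.univ.powersetCard k).filter
      (fun K => A.run (plantClique K H) = K)), K.card = k ∧
      (A.run (plantClique K H) = K ∧ A.numQueries (plantClique K H) ≤ q) := by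
    intro K hK
    rw [Finset.mem_filter, Finset.mem_powersetCard] at hK
    exact ⟨hK.1.2, hK.2, hq _⟩
  constructor
  · refine identifiesFew_run True H A q ∅ k _ (fun K hK => (hmem K hK).2) (by simp)
      fun K hK => ?_
    rw [← (hmem K hK).1]
    simp
  · refine identifiesFew_run False H A q ∅ (n - k) _ (fun K hK => (hmem K hK).2) (by simp)
      fun K hK => ?_
    rw [← (hmem K hK).1]
    simp only [Finset.notMem_empty, not_false_eq_true, true_and, iff_false]
    rw [← Finset.compl_filter, Finset.card_compl, Fintype.card_fin]
    simp

/-- The quotient of the two binomial coefficients is `∏ (d + i) / (n - k + i)` over `1 ≤ i ≤ k`. All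
factors are at most `1`, and the bound is the factor with `i = 1`. -/
lemma choose_add_mul_le {n k d : ℕ} (hk : 1 ≤ k) (hkn : d + k ≤ n) :
    (d + k).choose k * (n - k + 1) ≤ n.choose k * (d + 1) := by
  obtain ⟨j, rfl⟩ : ∃ j, k = j + 1 := ⟨k - 1, by omega⟩
  have h1 := Nat.choose_succ_right_eq (d + (j + 1)) j
  have h2 := Nat.choose_succ_right_eq n j
  rw [show d + (j + 1) - j = d + 1 by omega] at h1
  rw [show n - (j + 1) + 1 = n - j by omega]
  have h3 : (d + (j + 1)).choose j ≤ n.choose j := Nat.choose_le_choose j hkn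
  refine Nat.le_of_mul_le_mul_right (c := j + 1) ?_ (by omega)
  calc _ = ((d + (j + 1)).choose (j + 1) * (j + 1)) * (n - j) := by ring
    _ = (d + (j + 1)).choose j * ((d + 1) * (n - j)) := by rw [h1]; ring
    _ ≤ n.choose j * ((d + 1) * (n - j)) := Nat.mul_le_mul_right _ h3
    _ = (n.choose (j + 1) * (j + 1)) * (d + 1) := by rw [h2]; ring
    _ = _ := by ring

/-! ### The lower bound on the number of queries -/

lemma choose_add_div_le {n k d : ℕ} (hk : 1 ≤ k) (hkn : 2 * k ≤ n) :
    min (((d + k).choose k : ℝ)) (n.choose k) / n.choose k ≤ 2 * (d + 1) / n := by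
  have hpos : (0 : ℝ) < n.choose k := by exact_mod_cast Nat.choose_pos (by omega)
  have hn : (0 : ℝ) < n := by exact_mod_cast (by omega : 0 < n)
  rw [div_le_div_iff₀ hpos hn]
  by_cases h : d + k ≤ n
  · have h1 : ((d + k).choose k : ℝ) * (n - k + 1) ≤ n.choose k * (d + 1) := by
      have := choose_add_mul_le hk h
      have h2 : ((n - k : ℕ) : ℝ) = n - k := Nat.cast_sub (by omega)
      rw [← h2]
      exact_mod_cast this
    have h2 : (n : ℝ) ≤ 2 * (n - k + 1) := by
      have : (2 : ℝ) * k ≤ n := by exact_mod_cast hkn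
      linarith
    calc _ ≤ ((d + k).choose k : ℝ) * (2 * (n - k + 1)) := by
          gcongr
          exact min_le_left _ _
      _ ≤ _ := by linarith
  · have h1 : (n : ℝ) ≤ d + k := by exact_mod_cast (by omega : n ≤ d + k)
    have h2 : (2 : ℝ) * k ≤ n := by exact_mod_cast hkn
    calc _ ≤ (n.choose k : ℝ) * (2 * (d + 1)) := by
          gcongr
          · exact min_le_right _ _
          · linarith
      _ = _ := by ring

open Classical in
/-- The proportion of `k`-sets that are found with at most `q` queries. For `k² ≤ n` the queries
are unlikely to hit the clique; for larger `k` they cannot reach most of the vertices. -/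
lemma card_run_eq_div_le {n k q : ℕ} (hk : 1 ≤ k) (hkn : k < n)
    (A : Algorithm n (Finset (Fin n))) (H : SimpleGraph (Fin n))
    (hq : ∀ G, A.numQueries G ≤ q) :
    (((Finset.univ.powersetCard k).filter
      (fun K => A.run (plantClique K H) = K)).card : ℝ) / n.choose k ≤
      8 * (q / ((n : ℝ) ^ 2 / (k : ℝ) ^ 2 + n)) + 2 / n := by
  have hn : (0 : ℝ) < n := by exact_mod_cast (by omega : 0 < n)
  have hk' : (0 : ℝ) < k := by exact_mod_cast hk
  have hpos : (0 : ℝ) < n.choose k := by exact_mod_cast Nat.choose_pos hkn.le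
  set N := ((Finset.univ.powersetCard k).filter
      (fun K => A.run (plantClique K H) = K)).card with hN
  have hNle : N ≤ n.choose k := by
    refine (Finset.card_filter_le _ _).trans ?_
    simp
  rcases le_or_gt ((k : ℝ) ^ 2) n with hkk | hkk
  · have h1 : (N : ℝ) ≤ q * (n.choose k * (k ^ 2 / n ^ 2)) + 1 :=
      card_run_eq_le_of_pairs hk hkn.le A H (hq H)
    have h3 : (n : ℝ) ≤ n.choose k := by exact_mod_cast le_choose hk hkn
    have h4 : (n : ℝ) ^ 2 / (k : ℝ) ^ 2 + n ≤ 2 * (n ^ 2 / k ^ 2) := by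
      have : (n : ℝ) ≤ n ^ 2 / k ^ 2 := by
        rw [le_div_iff₀ (by positivity)]
        nlinarith
      linarith
    have h5 : (q : ℝ) * k ^ 2 / n ^ 2 ≤ 2 * (q / ((n : ℝ) ^ 2 / (k : ℝ) ^ 2 + n)) := by
      calc (q : ℝ) * k ^ 2 / n ^ 2 = 2 * (q / (2 * (n ^ 2 / k ^ 2))) := by field_simp
        _ ≤ _ := by gcongr
    calc (N : ℝ) / n.choose k ≤ (q * (n.choose k * (k ^ 2 / n ^ 2)) + 1) / n.choose k := by gcongr
      _ = q * (k ^ 2 / n ^ 2) + 1 / n.choose k := by field_simp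
      _ ≤ q * (k ^ 2 / n ^ 2) + 1 / n := by gcongr
      _ = q * k ^ 2 / n ^ 2 + 1 / n := by ring
      _ ≤ 2 * (q / ((n : ℝ) ^ 2 / (k : ℝ) ^ 2 + n)) + 1 / n := by gcongr
      _ ≤ _ := by gcongr <;> norm_num
  · have h1 : (N : ℝ) / n.choose k ≤ 2 * ((2 * q : ℕ) + 1) / n := by
      obtain ⟨ha, hb⟩ := card_run_eq_le_choose (k := k) A H hq
      rcases le_total (2 * k) n with h | h
      · refine le_trans ?_ (choose_add_div_le (d := 2 * q) hk h)
        gcongr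
        exact le_min (by exact_mod_cast ha) (by exact_mod_cast hNle)
      · have := choose_add_div_le (d := 2 * q) (k := n - k) (n := n) (by omega) (by omega)
        rw [Nat.choose_symm hkn.le] at this
        refine le_trans ?_ this
        gcongr
        exact le_min (by exact_mod_cast hb) (by exact_mod_cast hNle)
    have h4 : (n : ℝ) ^ 2 / (k : ℝ) ^ 2 + n ≤ 2 * n := by
      have : (n : ℝ) ^ 2 / k ^ 2 ≤ n := by
        rw [div_le_iff₀ (by positivity)]
        nlinarith
      linarith
    have h5 : (q : ℝ) / n ≤ 2 * (q / ((n : ℝ) ^ 2 / (k : ℝ) ^ 2 + n)) := by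
      calc (q : ℝ) / n = 2 * (q / (2 * n)) := by field_simp
        _ ≤ _ := by gcongr
    calc _ ≤ 2 * ((2 * q : ℕ) + 1 : ℝ) / n := h1
      _ = 4 * (q / n) + 2 / n := by push_cast; ring
      _ ≤ _ := by linarith

/-- The success probability of a randomized algorithm is a mixture of those of deterministic
ones. -/
lemma randomizedSuccessProb_le {n k : ℕ} (R : PMF (Algorithm n (Finset (Fin n)))) (c : ℝ≥0∞)
    (h : ∀ A ∈ R.support, successProb k A ≤ c) : randomizedSuccessProb k R ≤ c := by
  calc randomizedSuccessProb k R ≤ ∑' A, R A * c := by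
        refine ENNReal.tsum_le_tsum fun A => ?_
        by_cases hA : R A = 0
        · simp [hA]
        · gcongr
          exact h A ((PMF.mem_support_iff _ _).mpr hA)
    _ = c := by rw [ENNReal.tsum_mul_right, R.tsum_coe, one_mul]

theorem tendsto_randomizedSuccessProb (k q : ℕ → ℕ)
    (hk : ∀ᶠ n in atTop, 1 ≤ k n ∧ k n < n)
    (hq : (fun n => (q n : ℝ)) =o[atTop] fun n => (n : ℝ) ^ 2 / (k n : ℝ) ^ 2 + (n : ℝ))
    (R : (n : ℕ) → PMF (Algorithm n (Finset (Fin n))))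
    (hR : ∀ᶠ n in atTop, ∀ A ∈ (R n).support, ∀ G : SimpleGraph (Fin n),
      A.numQueries G ≤ q n) :
    Tendsto (fun n => randomizedSuccessProb (k n) (R n)) atTop (𝓝 0) := by
  classical
  have hlim : Tendsto (fun n : ℕ => ENNReal.ofReal
      (8 * (q n / ((n : ℝ) ^ 2 / (k n : ℝ) ^ 2 + n)) + 2 / n)) atTop (𝓝 0) := by
    rw [← ENNReal.ofReal_zero]
    refine ENNReal.tendsto_ofReal ?_
    have h1 := hq.tendsto_div_nhds_zero
    have h2 := tendsto_const_div_atTop_nhds_zero_nat (2 : ℝ)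
    simpa using (h1.const_mul 8).add h2
  refine tendsto_of_tendsto_of_tendsto_of_le_of_le' tendsto_const_nhds hlim
    (Eventually.of_forall fun _ => zero_le) ?_
  filter_upwards [hk, hR] with n hkn hRn
  refine randomizedSuccessProb_le _ _ fun A hA => successProb_le A _ fun H => ?_
  have := card_run_eq_div_le hkn.1 hkn.2 A H (hRn A hA)
  have hpos : (0 : ℝ) < n.choose (k n) := by exact_mod_cast Nat.choose_pos hkn.2.le
  rw [← ENNReal.ofReal_natCast, ← ENNReal.ofReal_natCast, ← ENNReal.ofReal_div_of_pos hpos]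
  exact ENNReal.ofReal_le_ofReal this

/-! ### The clique extension algorithm -/

namespace Algorithm

/-- Make the queries in `L`, then continue with the algorithm that `f` assigns to the list of the
answers. -/
def askAll {n : ℕ} {β : Type} : List (VertexPair n) → (List Bool → Algorithm n β) → Algorithm n β
  | [], f => f []
  | e :: L, f => query e (fun b => askAll L (fun a => f (b :: a)))

lemma run_askAll {n : ℕ} {β : Type} (L : List (VertexPair n)) (f : List Bool → Algorithm n β)
    (G : SimpleGraph (Fin n)) : (askAll L f).run G = (f (L.map (answer G))).run G := by
  induction L generalizing f with
  | nil => rfl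
  | cons e L ih => rw [askAll, run, ih]; rfl

lemma queries_askAll {n : ℕ} {β : Type} (L : List (VertexPair n))
    (f : List Bool → Algorithm n β) (G : SimpleGraph (Fin n)) :
    (askAll L f).queries G = L ++ (f (L.map (answer G))).queries G := by
  induction L generalizing f with
  | nil => rfl
  | cons e L ih => rw [askAll, queries, ih]; rfl

end Algorithm

open Classical in
/-- A graph that gives the answers `a` to the queries in `L` (the empty graph if there is none). -/
noncomputable def decode {n : ℕ} (L : List (VertexPair n)) (a : List Bool) :
    SimpleGraph (Fin n) :=
  if h : ∃ G : SimpleGraph (Fin n), L.map (answer G) = a then h.choose else ⊥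

lemma answer_decode {n : ℕ} (L : List (VertexPair n)) (G : SimpleGraph (Fin n))
    {e : VertexPair n} (he : e ∈ L) : answer (decode L (L.map (answer G))) e = answer G e := by
  have h : ∃ G' : SimpleGraph (Fin n), L.map (answer G') = L.map (answer G) := ⟨G, rfl⟩
  rw [decode, dif_pos h]
  exact List.map_inj_left.mp h.choose_spec e he

/-- The decoded graph agrees with `G` on every pair that `L` contains. The hypothesis covers both
orders of the pair, of which at most one is a `VertexPair`. -/
lemma decode_adj {n : ℕ} (L : List (VertexPair n)) (G : SimpleGraph (Fin n)) (u v : Fin n)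
    (h : ∀ e : VertexPair n, (e.1 = (u, v) ∨ e.1 = (v, u)) → e ∈ L) :
    (decode L (L.map (answer G))).Adj u v ↔ G.Adj u v := by
  have key : ∀ u v : Fin n, ∀ huv : u < v, (⟨(u, v), huv⟩ : VertexPair n) ∈ L →
      ((decode L (L.map (answer G))).Adj u v ↔ G.Adj u v) := by
    intro u v huv he
    simpa [answer] using answer_decode L G he
  rcases lt_trichotomy u v with huv | rfl | huv
  · exact key u v huv (h _ (Or.inl rfl))
  · simp
  · rw [SimpleGraph.adj_comm, G.adj_comm]
    exact key v u huv (h _ (Or.inr rfl))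

open Classical in
lemma exists_isLargestCliqueIn {n : ℕ} (G : SimpleGraph (Fin n)) (S : Finset (Fin n)) :
    ∃ D, IsLargestCliqueIn G S D := by
  obtain ⟨D, hD, hmax⟩ := Finset.exists_max_image
    (S.powerset.filter fun C : Finset (Fin n) => G.IsClique (C : Set (Fin n))) Finset.card
    ⟨∅, by simp⟩
  rw [Finset.mem_filter, Finset.mem_powerset] at hD
  exact ⟨D, hD.1, hD.2, fun C hC hC' =>
    hmax C (Finset.mem_filter.mpr ⟨Finset.mem_powerset.mpr hC, hC'⟩)⟩

lemma IsLargestCliqueIn.congr {n : ℕ} {G G' : SimpleGraph (Fin n)} {S D : Finset (Fin n)}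
    (h : ∀ u ∈ S, ∀ v ∈ S, (G.Adj u v ↔ G'.Adj u v)) (hD : IsLargestCliqueIn G S D) :
    IsLargestCliqueIn G' S D := by
  have hclique : ∀ C ⊆ S, G.IsClique (C : Set (Fin n)) ↔ G'.IsClique (C : Set (Fin n)) := by
    intro C hC
    constructor
    · intro hCl u hu v hv huv
      exact (h u (hC hu) v (hC hv)).mp (hCl hu hv huv)
    · intro hCl u hu v hv huv
      exact (h u (hC hu) v (hC hv)).mpr (hCl hu hv huv)
  exact ⟨hD.1, (hclique D hD.1).mp hD.2.1, fun C hC hC' => hD.2.2 C hC ((hclique C hC).mpr hC')⟩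

/-- A largest clique of the subgraph of `G` induced by `S`. -/
noncomputable def largestClique {n : ℕ} (G : SimpleGraph (Fin n)) (S : Finset (Fin n)) :
    Finset (Fin n) :=
  (exists_isLargestCliqueIn G S).choose

lemma isLargestCliqueIn_largestClique {n : ℕ} (G : SimpleGraph (Fin n)) (S : Finset (Fin n)) :
    IsLargestCliqueIn G S (largestClique G S) :=
  (exists_isLargestCliqueIn G S).choose_spec

/-- A subset of `D` with `min s #D` elements. It depends on `D` only, so that it is not random once
`D` is known to be the planted part of `S`. -/
noncomputable def subsetOfCard {n : ℕ} (s : ℕ) (D : Finset (Fin n)) : Finset (Fin n) :=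
  (Finset.exists_subset_card_eq (min_le_right s D.card)).choose

lemma subsetOfCard_subset {n : ℕ} (s : ℕ) (D : Finset (Fin n)) : subsetOfCard s D ⊆ D :=
  (Finset.exists_subset_card_eq (min_le_right s D.card)).choose_spec.1

lemma card_subsetOfCard {n : ℕ} (s : ℕ) (D : Finset (Fin n)) :
    (subsetOfCard s D).card = min s D.card :=
  (Finset.exists_subset_card_eq (min_le_right s D.card)).choose_spec.2

/-- The pairs within `S`. -/
noncomputable def pairsWithin {n : ℕ} (S : Finset (Fin n)) : List (VertexPair n) :=
  (Finset.univ.filter fun e : VertexPair n => e.1.1 ∈ S ∧ e.1.2 ∈ S).toList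

/-- The pairs with one vertex in `D` and the other outside `S`. -/
noncomputable def pairsAcross {n : ℕ} (S D : Finset (Fin n)) : List (VertexPair n) :=
  (Finset.univ.filter fun e : VertexPair n =>
    (e.1.1 ∈ D ∧ e.1.2 ∉ S) ∨ (e.1.2 ∈ D ∧ e.1.1 ∉ S)).toList

lemma mem_pairsWithin {n : ℕ} {S : Finset (Fin n)} {e : VertexPair n} :
    e ∈ pairsWithin S ↔ e.1.1 ∈ S ∧ e.1.2 ∈ S := by
  simp [pairsWithin]

lemma mem_pairsAcross {n : ℕ} {S D : Finset (Fin n)} {e : VertexPair n} :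
    e ∈ pairsAcross S D ↔ (e.1.1 ∈ D ∧ e.1.2 ∉ S) ∨ (e.1.2 ∈ D ∧ e.1.1 ∉ S) := by
  simp [pairsAcross]

lemma sym2_mk_injective (n : ℕ) :
    Function.Injective (fun e : VertexPair n => s(e.1.1, e.1.2)) := by
  rintro ⟨⟨a, b⟩, hab⟩ ⟨⟨c, d⟩, hcd⟩ h
  simp only [Sym2.eq_iff] at h
  rcases h with ⟨rfl, rfl⟩ | ⟨rfl, rfl⟩
  · rfl
  · exact absurd hab hcd.asymm

lemma length_pairsWithin_le {n : ℕ} (S : Finset (Fin n)) :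
    (pairsWithin S).length ≤ S.card.choose 2 := by
  rw [pairsWithin, Finset.length_toList, ← Sym2.card_image_offDiag]
  refine Finset.card_le_card_of_injOn _ (fun e he => ?_) (sym2_mk_injective n).injOn
  have he := (Finset.mem_filter.mp he).2
  exact Finset.mem_image.mpr ⟨e.1, Finset.mem_offDiag.mpr ⟨he.1, he.2, e.2.ne⟩, rfl⟩

lemma length_pairsAcross_le {n : ℕ} (S D : Finset (Fin n)) :
    (pairsAcross S D).length ≤ D.card * n := by
  rw [pairsAcross, Finset.length_toList]
  have : ((D ×ˢ (Finset.univ : Finset (Fin n))).image Sym2.mk.uncurry).card ≤ D.card * n := by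
    refine Finset.card_image_le.trans ?_
    simp
  refine le_trans ?_ this
  refine Finset.card_le_card_of_injOn _ (fun e he => ?_) (sym2_mk_injective n).injOn
  rcases (Finset.mem_filter.mp he).2 with h | h
  · exact Finset.mem_image.mpr ⟨(e.1.1, e.1.2), by simp [h.1], rfl⟩
  · exact Finset.mem_image.mpr ⟨(e.1.2, e.1.1), by simp [h.1], Sym2.eq_swap⟩

/-- The largest clique that the answers `a` to the first round show. -/
noncomputable def firstRoundClique {n : ℕ} (S : Finset (Fin n)) (a : List Bool) :
    Finset (Fin n) :=
  largestClique (decode (pairsWithin S) a) S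

/-- The queries of the second round, given the answers `a` to the first. -/
noncomputable def secondRound {n : ℕ} (S : Finset (Fin n)) (s : ℕ) (a : List Bool) :
    List (VertexPair n) :=
  pairsAcross S (subsetOfCard s (firstRoundClique S a))

open Classical in
/-- The clique `D` together with the vertices outside `S` that are adjacent to all of `D'`, where
`D' ⊆ D` is the chosen subset of `min s #D` elements. -/
noncomputable def extendClique {n : ℕ} (G : SimpleGraph (Fin n)) (S : Finset (Fin n)) (s : ℕ)
    (D : Finset (Fin n)) : Finset (Fin n) :=
  D ∪ Finset.univ.filter (fun v => v ∉ S ∧ ∀ u ∈ subsetOfCard s D, G.Adj u v)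

lemma extendClique_congr {n : ℕ} {G G' : SimpleGraph (Fin n)} {S : Finset (Fin n)} {s : ℕ}
    {D : Finset (Fin n)} (h : ∀ v ∉ S, ∀ u ∈ subsetOfCard s D, (G.Adj u v ↔ G'.Adj u v)) :
    extendClique G S s D = extendClique G' S s D := by
  have : ∀ v, (v ∉ S ∧ ∀ u ∈ subsetOfCard s D, G.Adj u v) ↔
      (v ∉ S ∧ ∀ u ∈ subsetOfCard s D, G'.Adj u v) :=
    fun v => and_congr_right fun hv => forall₂_congr fun u hu => h v hv u hu
  ext v
  simp only [extendClique, Finset.mem_union, Finset.mem_filter, this v]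

/-- The two-round algorithm: find a largest clique `D` in `S`, and extend `D` by the vertices
outside `S` that are adjacent to all vertices of a subset of `D` of size `min s #D`. -/
noncomputable def cliqueExtension {n : ℕ} (S : Finset (Fin n)) (s : ℕ) :
    Algorithm n (Finset (Fin n)) :=
  .askAll (pairsWithin S) fun a =>
    .askAll (secondRound S s a) fun b =>
      .output (extendClique (decode (secondRound S s a) b) S s (firstRoundClique S a))

lemma isLargestCliqueIn_firstRoundClique {n : ℕ} (G : SimpleGraph (Fin n)) (S : Finset (Fin n)) :
    IsLargestCliqueIn G S (firstRoundClique S ((pairsWithin S).map (answer G))) := by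
  refine (isLargestCliqueIn_largestClique _ S).congr fun u hu v hv => ?_
  refine decode_adj _ G u v fun e he => mem_pairsWithin.mpr ?_
  rcases he with he | he <;> rw [he] <;> simp [hu, hv]

lemma run_cliqueExtension {n : ℕ} (S : Finset (Fin n)) (s : ℕ) (G : SimpleGraph (Fin n)) :
    (cliqueExtension S s).run G =
      extendClique G S s (firstRoundClique S ((pairsWithin S).map (answer G))) := by
  rw [cliqueExtension, Algorithm.run_askAll, Algorithm.run_askAll, Algorithm.run]
  refine extendClique_congr fun v hv u hu => ?_
  refine decode_adj _ G u v fun e he => mem_pairsAcross.mpr ?_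
  rcases he with he | he <;> rw [he]
  · exact Or.inl ⟨hu, hv⟩
  · exact Or.inr ⟨hu, hv⟩

lemma queries_cliqueExtension {n : ℕ} (S : Finset (Fin n)) (s : ℕ) (G : SimpleGraph (Fin n)) :
    (cliqueExtension S s).queries G =
      pairsWithin S ++ secondRound S s ((pairsWithin S).map (answer G)) := by
  rw [cliqueExtension, Algorithm.queries_askAll, Algorithm.queries_askAll, Algorithm.queries,
    List.append_nil]

lemma isCliqueExtension_cliqueExtension {n : ℕ} (S : Finset (Fin n)) (s : ℕ) :
    IsCliqueExtension s (cliqueExtension S s) := by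
  refine ⟨S, pairsWithin S, secondRound S s, firstRoundClique S,
    fun a => subsetOfCard s (firstRoundClique S a), queries_cliqueExtension S s,
    fun e => mem_pairsWithin, ?_⟩
  rintro G a rfl
  refine ⟨isLargestCliqueIn_firstRoundClique G S, subsetOfCard_subset _ _, card_subsetOfCard _ _,
    fun e => mem_pairsAcross, ?_⟩
  rw [run_cliqueExtension, extendClique]

lemma numQueries_cliqueExtension_le {n : ℕ} (S : Finset (Fin n)) (s : ℕ)
    (G : SimpleGraph (Fin n)) :
    (cliqueExtension S s).numQueries G ≤ S.card.choose 2 + s * n := by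
  rw [Algorithm.numQueries, queries_cliqueExtension, List.length_append]
  refine add_le_add (length_pairsWithin_le S) ((length_pairsAcross_le _ _).trans ?_)
  rw [card_subsetOfCard]
  exact Nat.mul_le_mul_right _ (min_le_left _ _)

/-! ### The failure probability for a fixed planted set -/

lemma real_erdosRenyi_edges_le (n : ℕ) (E : Finset (Sym2 (Fin n))) :
    (erdosRenyi n).real {H | ∀ e ∈ E, e ∈ H.edgeSet} ≤ (1 / 2 : ℝ) ^ E.card := by
  have h := ENNReal.toReal_mono (by simp) (erdosRenyi_edges_le n E)
  simpa [measureReal_def] using h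

/-- The pairs in `C` that do not lie in `B`. -/
def pairsNotIn {n : ℕ} (C B : Finset (Fin n)) : Finset (Sym2 (Fin n)) :=
  C.offDiag.image Sym2.mk.uncurry \ (C ∩ B).offDiag.image Sym2.mk.uncurry

/-- A set of `ℓ` vertices, `i` of which lie outside `B`, spans at least `i (ℓ - 1) / 2` pairs that
do not lie in `B`. The division is rounded down before the multiplication by `i`. -/
lemma mul_le_card_pairsNotIn {n : ℕ} (C B : Finset (Fin n)) :
    (C \ B).card * ((C.card - 1) / 2) ≤ (pairsNotIn C B).card := by
  have hsub : (C ∩ B).offDiag.image Sym2.mk.uncurry ⊆ C.offDiag.image Sym2.mk.uncurry :=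
    Finset.image_subset_image (Finset.offDiag_mono Finset.inter_subset_left)
  have h1 := Sym2.two_mul_card_image_offDiag C
  have h2 := Sym2.two_mul_card_image_offDiag (C ∩ B)
  have h3 := Finset.card_sdiff_add_card_eq_card hsub
  have h4 := Finset.card_sdiff_add_card_inter C B
  rw [Finset.offDiag_card] at h1 h2
  change (C \ B).card * ((C.card - 1) / 2) ≤
    (C.offDiag.image Sym2.mk.uncurry \ (C ∩ B).offDiag.image Sym2.mk.uncurry).card
  set i := (C \ B).card
  set j := (C ∩ B).card
  set x := (C.offDiag.image Sym2.mk.uncurry).card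
  set y := ((C ∩ B).offDiag.image Sym2.mk.uncurry).card
  set z := (C.offDiag.image Sym2.mk.uncurry \ (C ∩ B).offDiag.image Sym2.mk.uncurry).card
  rw [← h4] at h1 ⊢
  rcases Nat.eq_zero_or_pos i with hi | hi
  · simp [hi]
  have h5 : 2 * ((i + j - 1) / 2) ≤ i + j - 1 := Nat.mul_div_le _ _
  obtain ⟨t, ht⟩ : ∃ t, i + j = t + 1 := ⟨i + j - 1, by omega⟩
  have h6 : 2 * x + (i + j) = (i + j) * (i + j) := by
    rw [h1]; exact Nat.sub_add_cancel (Nat.le_mul_self _)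
  have h7 : 2 * y + j = j * j := by
    rw [h2]; exact Nat.sub_add_cancel (Nat.le_mul_self _)
  rw [ht, Nat.add_sub_cancel] at h5 ⊢
  set w := t / 2
  have h8 : i * (2 * w) ≤ i * t := Nat.mul_le_mul_left _ h5
  have h10 : i * t + i = i * i + i * j := by
    rw [← Nat.mul_succ, Nat.succ_eq_add_one, ← ht]; ring
  nlinarith

/-- If the largest clique found in `S` is not the planted part `K ∩ S`, then some other set of the
same size has all its pairs outside `K` among the edges of the Erdős–Rényi graph. -/
lemma exists_pairsNotIn_subset_edgeSet {n : ℕ} {K S D : Finset (Fin n)} {H : SimpleGraph (Fin n)}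
    (hpos : 1 ≤ (K ∩ S).card) (hD : IsLargestCliqueIn (plantClique K H) S D) (hne : D ≠ K ∩ S) :
    ∃ C, C.card = (K ∩ S).card ∧ C ≠ K ∩ S ∧ ∀ e ∈ pairsNotIn C (K ∩ S), e ∈ H.edgeSet := by
  obtain ⟨hDS, hDcl, hDmax⟩ := hD
  have hcard : (K ∩ S).card ≤ D.card := by
    refine hDmax _ Finset.inter_subset_right fun u hu v hv huv => ?_
    rw [plantClique_adj]
    exact Or.inr ⟨huv, (Finset.mem_inter.mp hu).1, (Finset.mem_inter.mp hv).1⟩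
  obtain ⟨w, hwD, hwB⟩ : ∃ w ∈ D, w ∉ K ∩ S := by
    by_contra! h
    exact hne (Finset.eq_of_subset_of_card_le h hcard)
  obtain ⟨C, hwC, hCD, hC⟩ := Finset.exists_subsuperset_card_eq
    (Finset.singleton_subset_iff.mpr hwD) (by simpa using hpos) hcard
  refine ⟨C, hC, fun h => hwB (h ▸ Finset.singleton_subset_iff.mp hwC), fun e he => ?_⟩
  rw [pairsNotIn, Finset.mem_sdiff] at he
  obtain ⟨he, heB⟩ := he
  obtain ⟨⟨u, v⟩, huv, rfl⟩ := Finset.mem_image.mp he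
  rw [Finset.mem_offDiag] at huv
  obtain ⟨hu, hv, huv⟩ := huv
  have hadj := hDcl (hCD hu) (hCD hv) huv
  rw [plantClique_adj] at hadj
  rcases hadj with hadj | hadj
  · exact hadj
  · refine absurd (Finset.mem_image.mpr ⟨(u, v), Finset.mem_offDiag.mpr ⟨?_, ?_, huv⟩, rfl⟩) heB
    · exact Finset.mem_inter.mpr ⟨hu, Finset.mem_inter.mpr ⟨hadj.2.1, hDS (hCD hu)⟩⟩
    · exact Finset.mem_inter.mpr ⟨hv, Finset.mem_inter.mpr ⟨hadj.2.2, hDS (hCD hv)⟩⟩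

/-- There are at most `(#B n)ⁱ` ways to exchange `i` vertices of `B` for `i` others. -/
lemma card_exchange_le {n : ℕ} (B : Finset (Fin n)) (i : ℕ) :
    (Finset.univ.filter fun C : Finset (Fin n) =>
      C.card = B.card ∧ (C \ B).card = i).card ≤ (B.card * n) ^ i := by
  have h : (Finset.univ.filter fun C : Finset (Fin n) =>
      C.card = B.card ∧ (C \ B).card = i).card ≤
      (B.powersetCard i ×ˢ (Finset.univ : Finset (Fin n)).powersetCard i).card := by
    refine Finset.card_le_card_of_injOn (fun C => (B \ C, C \ B)) (fun C hC => ?_) ?_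
    · obtain ⟨h1, h2⟩ := (Finset.mem_filter.mp hC).2
      have h3 : (B \ C).card = i := by
        have := Finset.card_sdiff_add_card_inter C B
        have := Finset.card_sdiff_add_card_inter B C
        rw [Finset.inter_comm] at this
        omega
      simp [Finset.mem_powersetCard, h2, h3, Finset.sdiff_subset]
    · intro C _ C' _ hCC
      simp only [Prod.mk.injEq] at hCC
      have hrec : ∀ C : Finset (Fin n), (B \ (B \ C)) ∪ (C \ B) = C := by
        intro C; ext x; simp; tauto
      rw [← hrec C, ← hrec C', hCC.1, hCC.2]
  refine h.trans ?_
  rw [Finset.card_product, Finset.card_powersetCard, Finset.card_powersetCard, Finset.card_univ,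
    Fintype.card_fin, mul_pow]
  exact Nat.mul_le_mul (Nat.choose_le_pow _ _) (Nat.choose_le_pow _ _)

/-- The union bound over the sets `C ≠ B` of the size of `B`, sorted by the number `i` of their
vertices outside `B`: the bounds form a geometric series. -/
lemma real_erdosRenyi_exists_pairsNotIn_le {n : ℕ} (B : Finset (Fin n))
    (hr : (B.card * n : ℝ) * (1 / 2) ^ ((B.card - 1) / 2) ≤ 1 / 2) :
    (erdosRenyi n).real {H | ∃ C, C.card = B.card ∧ C ≠ B ∧
      ∀ e ∈ pairsNotIn C B, e ∈ H.edgeSet} ≤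
      2 * ((B.card * n : ℝ) * (1 / 2) ^ ((B.card - 1) / 2)) := by
  set r : ℝ := (B.card * n : ℝ) * (1 / 2) ^ ((B.card - 1) / 2) with hrdef
  have hr0 : 0 ≤ r := by positivity
  have hsub : {H : SimpleGraph (Fin n) | ∃ C, C.card = B.card ∧ C ≠ B ∧
      ∀ e ∈ pairsNotIn C B, e ∈ H.edgeSet} ⊆
      ⋃ i ∈ Finset.Icc 1 B.card, ⋃ C ∈ Finset.univ.filter fun C : Finset (Fin n) =>
        C.card = B.card ∧ (C \ B).card = i, {H | ∀ e ∈ pairsNotIn C B, e ∈ H.edgeSet} := by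
    rintro H ⟨C, hC, hne, hH⟩
    simp only [Set.mem_iUnion]
    refine ⟨(C \ B).card, Finset.mem_Icc.mpr ⟨?_, ?_⟩, C, by simp [hC], hH⟩
    · refine Nat.one_le_iff_ne_zero.mpr fun h => hne ?_
      rw [Finset.card_eq_zero, Finset.sdiff_eq_empty_iff_subset] at h
      exact Finset.eq_of_subset_of_card_le h hC.ge
    · exact (Finset.card_le_card Finset.sdiff_subset).trans hC.le
  have hterm : ∀ i, (erdosRenyi n).real (⋃ C ∈ Finset.univ.filter fun C : Finset (Fin n) =>
        C.card = B.card ∧ (C \ B).card = i, {H | ∀ e ∈ pairsNotIn C B, e ∈ H.edgeSet}) ≤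
        r ^ i := by
    intro i
    refine (measureReal_biUnion_finset_le _ _).trans ?_
    refine (Finset.sum_le_card_nsmul _ _ (((1 / 2 : ℝ) ^ ((B.card - 1) / 2)) ^ i)
      fun C hC => ?_).trans ?_
    · obtain ⟨h1, h2⟩ := (Finset.mem_filter.mp hC).2
      refine (real_erdosRenyi_edges_le n _).trans ?_
      rw [← pow_mul]
      refine pow_le_pow_of_le_one (by norm_num) (by norm_num) ?_
      have := mul_le_card_pairsNotIn C B
      rwa [h1, h2, mul_comm] at this
    · rw [nsmul_eq_mul, hrdef, mul_pow]
      gcongr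
      exact_mod_cast card_exchange_le B i
  calc _ ≤ (erdosRenyi n).real _ := measureReal_mono hsub (measure_ne_top _ _)
    _ ≤ ∑ i ∈ Finset.Icc 1 B.card, r ^ i :=
        (measureReal_biUnion_finset_le _ _).trans (Finset.sum_le_sum fun i _ => hterm i)
    _ ≤ ∑ i ∈ Finset.range B.card, r * (1 / 2) ^ i := by
        rw [← Finset.Ico_add_one_right_eq_Icc, Finset.sum_Ico_eq_sum_range]
        rw [Nat.add_sub_cancel]
        refine Finset.sum_le_sum fun i _ => ?_
        rw [add_comm, pow_succ']
        gcongr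
    _ ≤ r * 2 := by
        rw [← Finset.mul_sum]
        gcongr
        exact sum_geometric_two_le _
    _ = 2 * r := mul_comm _ _

/-- The probability that some vertex outside the clique looks as if it belonged to it. -/
lemma real_erdosRenyi_exists_adj_le {n : ℕ} (D : Finset (Fin n)) :
    (erdosRenyi n).real {H | ∃ v, ∀ u ∈ D, H.Adj u v} ≤ n * (1 / 2) ^ D.card := by
  have hsub : {H : SimpleGraph (Fin n) | ∃ v, ∀ u ∈ D, H.Adj u v} ⊆
      ⋃ v ∈ (Finset.univ : Finset (Fin n)),
        {H | ∀ e ∈ D.image (fun u => s(u, v)), e ∈ H.edgeSet} := by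
    rintro H ⟨v, hv⟩
    simp only [Set.mem_iUnion]
    refine ⟨v, Finset.mem_univ _, fun e he => ?_⟩
    obtain ⟨u, hu, rfl⟩ := Finset.mem_image.mp he
    exact hv u hu
  refine (measureReal_mono hsub (measure_ne_top _ _)).trans
    ((measureReal_biUnion_finset_le _ _).trans ?_)
  refine (Finset.sum_le_card_nsmul _ _ ((1 / 2 : ℝ) ^ D.card) fun v _ => ?_).trans (by simp)
  refine (real_erdosRenyi_edges_le n _).trans (le_of_eq ?_)
  rw [Finset.card_image_of_injective _ fun a b hab => Sym2.congr_left.mp hab]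

lemma run_cliqueExtension_eq {n : ℕ} {K S : Finset (Fin n)} {s : ℕ} {H : SimpleGraph (Fin n)}
    (hD : firstRoundClique S ((pairsWithin S).map (answer (plantClique K H))) = K ∩ S)
    (hT : ¬ ∃ v, ∀ u ∈ subsetOfCard s (K ∩ S), H.Adj u v) :
    (cliqueExtension S s).run (plantClique K H) = K := by
  rw [run_cliqueExtension, hD]
  have hsub := subsetOfCard_subset s (K ∩ S)
  ext v
  simp only [extendClique, Finset.mem_union, Finset.mem_filter, Finset.mem_univ, true_and,
    Finset.mem_inter, plantClique_adj]
  constructor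
  · rintro (h | ⟨hvS, hadj⟩)
    · exact h.1
    · by_contra hvK
      refine hT ⟨v, fun u hu => ?_⟩
      rcases hadj u hu with h | h
      · exact h
      · exact absurd h.2.2 hvK
  · intro hvK
    by_cases hvS : v ∈ S
    · exact Or.inl ⟨hvK, hvS⟩
    · refine Or.inr ⟨hvS, fun u hu => Or.inr ⟨?_, (Finset.mem_inter.mp (hsub hu)).1, hvK⟩⟩
      rintro rfl
      exact hvS (Finset.mem_inter.mp (hsub hu)).2

lemma real_erdosRenyi_run_ne_le {n : ℕ} (K S : Finset (Fin n)) (s : ℕ)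
    (hpos : 1 ≤ (K ∩ S).card)
    (hr : ((K ∩ S).card * n : ℝ) * (1 / 2) ^ (((K ∩ S).card - 1) / 2) ≤ 1 / 2) :
    (erdosRenyi n).real {H | (cliqueExtension S s).run (plantClique K H) ≠ K} ≤
      2 * (((K ∩ S).card * n : ℝ) * (1 / 2) ^ (((K ∩ S).card - 1) / 2)) +
        n * (1 / 2) ^ (min s (K ∩ S).card) := by
  rw [← card_subsetOfCard]
  refine le_trans (measureReal_mono ?_) ((measureReal_union_le _ _).trans (add_le_add
    (real_erdosRenyi_exists_pairsNotIn_le (K ∩ S) hr)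
    (real_erdosRenyi_exists_adj_le (subsetOfCard s (K ∩ S)))))
  intro H hH
  by_cases hD : firstRoundClique S ((pairsWithin S).map (answer (plantClique K H))) = K ∩ S
  · right
    by_contra hT
    exact hH (run_cliqueExtension_eq hD hT)
  · left
    exact exists_pairsNotIn_subset_edgeSet hpos (isLargestCliqueIn_firstRoundClique _ S) hD

/-! ### The planted part of a fixed set of vertices -/

open Classical in
/-- The variance of the hypergeometric distribution is at most its mean: `u ∈ K` and `v ∈ K` are
negatively correlated for `u ≠ v`. -/
lemma sum_sq_card_inter_sub_le {n k : ℕ} (hn : 0 < n) (hk : 1 ≤ k) (hkn : k ≤ n)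
    (S : Finset (Fin n)) :
    ∑ K ∈ (Finset.univ : Finset (Fin n)).powersetCard k,
      (((K ∩ S).card : ℝ) - S.card * k / n) ^ 2 ≤ n.choose k * (S.card * k / n) := by
  have hn' : (0 : ℝ) < n := by exact_mod_cast hn
  set P := (Finset.univ : Finset (Fin n)).powersetCard k with hP
  set N : ℝ := (n.choose k : ℝ)
  set μ : ℝ := S.card * k / n with hμ
  have hPcard : (P.card : ℝ) = N := by
    rw [hP, Finset.card_powersetCard, Finset.card_univ, Fintype.card_fin]
  have hX : ∀ K : Finset (Fin n), ((K ∩ S).card : ℝ) = ∑ u ∈ S, if u ∈ K then 1 else 0 := by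
    intro K
    rw [Finset.sum_boole, Finset.filter_mem_eq_inter, Finset.inter_comm]
  have hone : ∀ u : Fin n, ∑ K ∈ P, (if u ∈ K then (1 : ℝ) else 0) = N * (k / n) := by
    intro u
    rw [Finset.sum_boole, ← mul_div_assoc, eq_div_iff hn'.ne']
    exact card_powersetCard_mem hk u
  have htwo : ∀ u v : Fin n, u ≠ v →
      ∑ K ∈ P, (if u ∈ K then (1 : ℝ) else 0) * (if v ∈ K then 1 else 0) ≤
        N * (k ^ 2 / n ^ 2) := by
    intro u v huv
    simp only [← ite_and, mul_ite, mul_one, mul_zero]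
    rw [Finset.sum_boole]
    convert card_powersetCard_mem_mem_le hk hkn huv.symm using 3
  have hsum : ∑ K ∈ P, ((K ∩ S).card : ℝ) = N * μ := by
    simp only [hX]
    rw [Finset.sum_comm]
    simp only [hone]
    rw [Finset.sum_const, nsmul_eq_mul, hμ]
    ring
  have hsq : ∑ K ∈ P, ((K ∩ S).card : ℝ) ^ 2 ≤ N * μ + N * μ ^ 2 := by
    have h1 : ∑ K ∈ P, ((K ∩ S).card : ℝ) ^ 2 = ∑ u ∈ S, ∑ v ∈ S,
        ∑ K ∈ P, (if u ∈ K then (1 : ℝ) else 0) * (if v ∈ K then 1 else 0) := by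
      simp only [hX, sq, Finset.sum_mul_sum]
      rw [Finset.sum_comm]
      refine Finset.sum_congr rfl fun u _ => Finset.sum_comm
    have h2 : ∀ u v : Fin n,
        ∑ K ∈ P, (if u ∈ K then (1 : ℝ) else 0) * (if v ∈ K then 1 else 0) ≤
          (if u = v then N * (k / n) else 0) + N * (k ^ 2 / n ^ 2) := by
      intro u v
      by_cases huv : u = v
      · subst huv
        simp only [if_true, mul_ite, mul_one, mul_zero]
        rw [← hone u]
        have : 0 ≤ N * ((k : ℝ) ^ 2 / n ^ 2) := by positivity
        refine le_add_of_le_of_nonneg (Finset.sum_le_sum fun K _ => ?_) this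
        by_cases h : u ∈ K <;> simp [h]
      · simpa [huv] using htwo u v huv
    rw [h1]
    refine (Finset.sum_le_sum fun u _ => Finset.sum_le_sum fun v _ => h2 u v).trans (le_of_eq ?_)
    simp only [Finset.sum_add_distrib, Finset.sum_ite_eq, Finset.sum_const, nsmul_eq_mul]
    rw [Finset.sum_ite_mem, Finset.inter_self, Finset.sum_const, nsmul_eq_mul, hμ]
    ring
  calc _ = ∑ K ∈ P, ((K ∩ S).card : ℝ) ^ 2 - 2 * μ * ∑ K ∈ P, ((K ∩ S).card : ℝ) +
        P.card * μ ^ 2 := by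
        rw [Finset.mul_sum, ← Finset.sum_sub_distrib, ← nsmul_eq_mul, ← Finset.sum_const,
          ← Finset.sum_add_distrib]
        exact Finset.sum_congr rfl fun K _ => by ring
    _ ≤ _ := by rw [hsum, hPcard]; linarith

open ProbabilityTheory in
/-- Chebyshev's inequality. -/
lemma uniformOn_card_inter_lt_le {n k : ℕ} (hn : 0 < n) (hk : 1 ≤ k) (hkn : k ≤ n)
    (S : Finset (Fin n)) {t x : ℝ} (ht : 0 < t) (hx : x ≤ S.card * k / n - t) :
    uniformOn {K : Finset (Fin n) | K.card = k} {K | ((K ∩ S).card : ℝ) < x} ≤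
      ENNReal.ofReal ((S.card * k / n) / t ^ 2) := by
  classical
  have hpos : (0 : ℝ) < n.choose k := by exact_mod_cast Nat.choose_pos hkn
  rw [uniformOn_card_apply, ← ENNReal.ofReal_natCast, ← ENNReal.ofReal_natCast,
    ← ENNReal.ofReal_div_of_pos hpos]
  refine ENNReal.ofReal_le_ofReal ?_
  rw [div_le_div_iff₀ hpos (by positivity), mul_comm (_ / _) _]
  refine le_trans ?_ (sum_sq_card_inter_sub_le hn hk hkn S)
  rw [← nsmul_eq_mul, ← Finset.sum_const]
  refine le_trans (Finset.sum_le_sum fun K hK => ?_)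
    (Finset.sum_le_sum_of_subset_of_nonneg (Finset.filter_subset _ _) fun _ _ _ => sq_nonneg _)
  have h : ((K ∩ S).card : ℝ) < x := (Finset.mem_filter.mp hK).2
  nlinarith

/-! ### The algorithm finds the planted clique -/

/-- The number of vertices among which the clique extension algorithm looks for a largest clique.
It is chosen such that about `√(4 + 2 ε₀) log₂ n` of them belong to the planted clique; if that
would take more than `n` vertices, then all are used. -/
noncomputable def sampleSize (ε₀ : ℝ) (n k : ℕ) : ℕ :=
  min n ⌊√(4 + 2 * ε₀) * (n * Real.logb 2 n / k)⌋₊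

lemma sampleSize_le (ε₀ : ℝ) (n k : ℕ) : sampleSize ε₀ n k ≤ n := min_le_left _ _

/-- The first `m` vertices. -/
def initialVertices (n m : ℕ) : Finset (Fin n) := Finset.univ.filter fun v => v.val < m

lemma card_initialVertices {n m : ℕ} (h : m ≤ n) : (initialVertices n m).card = m := by
  rw [initialVertices, Fin.card_filter_val_lt, min_eq_right h]

/-- The clique extension algorithm with the sizes of `S` and `D'` that prove the upper bound. -/
noncomputable def cliqueFinder (ε₀ : ℝ) (n k : ℕ) : Algorithm n (Finset (Fin n)) :=
  cliqueExtension (initialVertices n (sampleSize ε₀ n k)) ⌊(1 + ε₀) * Real.logb 2 n⌋₊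

lemma numQueries_cliqueFinder_le {ε₀ : ℝ} (hε₀ : 0 < ε₀) {n k : ℕ} (hk : 1 ≤ k) (hkn : k < n)
    (G : SimpleGraph (Fin n)) :
    ((cliqueFinder ε₀ n k).numQueries G : ℝ) ≤
      (2 + ε₀) * ((n : ℝ) ^ 2 / (k : ℝ) ^ 2) * (Real.logb 2 n) ^ 2 +
        (1 + ε₀) * n * Real.logb 2 n := by
  have hL : 0 ≤ Real.logb 2 n :=
    Real.logb_nonneg (by norm_num) (by exact_mod_cast (by omega : 1 ≤ n))
  have hk' : (0 : ℝ) < k := by exact_mod_cast hk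
  have h := numQueries_cliqueExtension_le (initialVertices n (sampleSize ε₀ n k))
    ⌊(1 + ε₀) * Real.logb 2 n⌋₊ G
  rw [card_initialVertices (sampleSize_le _ _ _)] at h
  set L := Real.logb 2 n
  have hm : (sampleSize ε₀ n k : ℝ) ≤ √(4 + 2 * ε₀) * (n * L / k) :=
    (Nat.cast_le.mpr (min_le_right _ _)).trans (Nat.floor_le (by positivity))
  have hs : (⌊(1 + ε₀) * L⌋₊ : ℝ) ≤ (1 + ε₀) * L := Nat.floor_le (by positivity)
  have hc : ((sampleSize ε₀ n k).choose 2 : ℝ) ≤ (sampleSize ε₀ n k : ℝ) ^ 2 / 2 := by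
    rw [Nat.cast_choose_two]
    have : (0 : ℝ) ≤ sampleSize ε₀ n k := Nat.cast_nonneg _
    nlinarith
  calc ((cliqueFinder ε₀ n k).numQueries G : ℝ)
      ≤ (sampleSize ε₀ n k).choose 2 + ⌊(1 + ε₀) * L⌋₊ * n := by exact_mod_cast h
    _ ≤ (√(4 + 2 * ε₀) * (n * L / k)) ^ 2 / 2 + (1 + ε₀) * L * n := by
        refine add_le_add (hc.trans ?_) ?_ <;> gcongr
    _ = _ := by
        rw [mul_pow, Real.sq_sqrt (by positivity)]
        field_simp
        ring

lemma half_pow_eq_rpow (m : ℕ) : (1 / 2 : ℝ) ^ m = (2 : ℝ) ^ (-(m : ℝ)) := by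
  rw [Real.rpow_neg (by norm_num), Real.rpow_natCast, one_div, inv_pow]

lemma le_two_mul_two_rpow (y : ℝ) : y ≤ 2 * (2 : ℝ) ^ y := by
  rcases le_or_gt y 0 with hy | hy
  · exact hy.trans (by positivity)
  rw [Real.rpow_def_of_pos (by norm_num)]
  have h1 := Real.add_one_le_exp (Real.log 2 * y)
  have h2 := Real.log_two_gt_d9
  nlinarith

/-- A planted part of at least `(2 + δ) log₂ n` vertices is so large that no other set of its size
is a clique. -/
lemma mul_half_pow_le {n ℓ : ℕ} (hn : 1 ≤ n) {δ γ : ℝ} (hδ : 0 < δ)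
    (hγ : γ = 1 / 2 - 1 / (2 + δ)) (hℓ : (2 + δ) * Real.logb 2 n ≤ ℓ) :
    (ℓ * n : ℝ) * (1 / 2) ^ ((ℓ - 1) / 2) ≤ 8 / γ * (n : ℝ) ^ (-γ) := by
  have hn' : (0 : ℝ) < n := by exact_mod_cast hn
  have hL : 0 ≤ Real.logb 2 n := Real.logb_nonneg (by norm_num) (by exact_mod_cast hn)
  have hγ0 : 0 < γ := by
    rw [hγ, sub_pos]
    exact one_div_lt_one_div_of_lt (by norm_num) (by linarith)
  have hnL : (n : ℝ) = 2 ^ (Real.logb 2 n) :=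
    (Real.rpow_logb (by norm_num) (by norm_num) hn').symm
  set L := Real.logb 2 n
  have h1 : (ℓ : ℝ) ≤ 4 / γ * 2 ^ (γ * ℓ / 2) := by
    have := le_two_mul_two_rpow (γ * ℓ / 2)
    rw [div_mul_eq_mul_div, le_div_iff₀ hγ0]
    linarith
  have h2 : (n : ℝ) ≤ 2 ^ ((ℓ : ℝ) / (2 + δ)) := by
    rw [hnL]
    refine Real.rpow_le_rpow_of_exponent_le (by norm_num) ?_
    rw [le_div_iff₀ (by positivity)]
    linarith
  have h3 : (1 / 2 : ℝ) ^ ((ℓ - 1) / 2) ≤ 2 ^ (1 - (ℓ : ℝ) / 2) := by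
    rw [half_pow_eq_rpow]
    refine Real.rpow_le_rpow_of_exponent_le (by norm_num) ?_
    have : (ℓ : ℝ) ≤ 2 * ((ℓ - 1) / 2 : ℕ) + 2 := by
      exact_mod_cast (by omega : ℓ ≤ 2 * ((ℓ - 1) / 2) + 2)
    linarith
  calc (ℓ * n : ℝ) * (1 / 2) ^ ((ℓ - 1) / 2)
      ≤ (4 / γ * 2 ^ (γ * ℓ / 2) * 2 ^ ((ℓ : ℝ) / (2 + δ))) * 2 ^ (1 - (ℓ : ℝ) / 2) := by
        gcongr
    _ = 4 / γ * 2 ^ (γ * ℓ / 2 + (ℓ : ℝ) / (2 + δ) + (1 - (ℓ : ℝ) / 2)) := by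
        rw [Real.rpow_add (by norm_num), Real.rpow_add (by norm_num)]
        ring
    _ = 4 / γ * 2 ^ (1 - γ * ℓ / 2) := by
        congr 2
        rw [hγ]
        ring
    _ ≤ 4 / γ * 2 ^ (1 + L * (-γ)) := by
        gcongr
        · norm_num
        · have : 2 * L ≤ ℓ := by nlinarith
          nlinarith
    _ = 8 / γ * (n : ℝ) ^ (-γ) := by
        rw [hnL, ← Real.rpow_mul (by norm_num), Real.rpow_add (by norm_num), Real.rpow_one]
        ring

lemma mul_half_pow_min_le {n ℓ : ℕ} (hn : 1 ≤ n) {δ ε₀ η : ℝ} (hδ : 0 < δ) (hη : η ≤ ε₀)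
    (hη1 : η ≤ 1) (hℓ : (2 + δ) * Real.logb 2 n ≤ ℓ) :
    (n : ℝ) * (1 / 2) ^ (min ⌊(1 + ε₀) * Real.logb 2 n⌋₊ ℓ) ≤ 2 * (n : ℝ) ^ (-η) := by
  have hn' : (0 : ℝ) < n := by exact_mod_cast hn
  have hL : 0 ≤ Real.logb 2 n := Real.logb_nonneg (by norm_num) (by exact_mod_cast hn)
  have hnL : (n : ℝ) = 2 ^ (Real.logb 2 n) :=
    (Real.rpow_logb (by norm_num) (by norm_num) hn').symm
  set L := Real.logb 2 n
  have h1 : (1 + η) * L - 1 ≤ (min ⌊(1 + ε₀) * L⌋₊ ℓ : ℕ) := by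
    rw [Nat.cast_min]
    refine le_min ?_ ?_
    · have := Nat.lt_floor_add_one ((1 + ε₀) * L)
      nlinarith
    · nlinarith
  rw [half_pow_eq_rpow]
  calc (n : ℝ) * 2 ^ (-((min ⌊(1 + ε₀) * L⌋₊ ℓ : ℕ) : ℝ))
      ≤ 2 ^ L * 2 ^ (1 - (1 + η) * L) := by
        rw [← hnL]
        gcongr
        · norm_num
        · linarith
    _ = 2 ^ (1 + L * (-η)) := by
        rw [← Real.rpow_add (by norm_num)]
        congr 1
        ring
    _ = 2 * (n : ℝ) ^ (-η) := by
        rw [hnL, ← Real.rpow_mul (by norm_num), Real.rpow_add (by norm_num), Real.rpow_one]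

open ProbabilityTheory in
/-- The planted part of the sample is large with high probability: by Chebyshev's inequality, and
trivially if the sample consists of all vertices. -/
lemma uniformOn_planted_part_lt_le {ε ε₀ δ : ℝ} (hε₀ : 0 < ε₀) (hδ : 0 < δ) (hδε : δ ≤ ε)
    (hδc : 2 + 3 * δ ≤ √(4 + 2 * ε₀)) {n k : ℕ} (hk : 1 ≤ k) (hkn : k < n)
    (hkL : (2 + ε) * Real.logb 2 n ≤ k) (hL : 1 ≤ δ * Real.logb 2 n) :
    uniformOn {K : Finset (Fin n) | K.card = k}
      {K | ((K ∩ initialVertices n (sampleSize ε₀ n k)).card : ℝ) <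
        (2 + δ) * Real.logb 2 n} ≤
      ENNReal.ofReal (√(4 + 2 * ε₀) / δ ^ 2 * (Real.logb 2 n)⁻¹) := by
  classical
  have hk' : (0 : ℝ) < k := by exact_mod_cast hk
  have hn' : (0 : ℝ) < n := by exact_mod_cast (by omega : 0 < n)
  have hkn' : (k : ℝ) ≤ n := by exact_mod_cast hkn.le
  have hL0 : 0 < Real.logb 2 n := by
    by_contra! h
    nlinarith
  set L := Real.logb 2 n
  set c := √(4 + 2 * ε₀)
  rcases le_or_gt n ⌊c * (n * L / k)⌋₊ with hm | hm
  · have hm' : sampleSize ε₀ n k = n := min_eq_left hm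
    have huniv : initialVertices n n = Finset.univ := by
      ext v; simp [initialVertices]
    rw [hm', huniv, uniformOn_card_apply, Finset.filter_eq_empty_iff.mpr]
    · simp
    · intro K hK h
      rw [Set.mem_ofPred_eq, Finset.inter_univ, (Finset.mem_powersetCard.mp hK).2] at h
      nlinarith
  · have hm' : sampleSize ε₀ n k = ⌊c * (n * L / k)⌋₊ := min_eq_right hm.le
    have hcard : (initialVertices n (sampleSize ε₀ n k)).card = ⌊c * (n * L / k)⌋₊ := by
      rw [card_initialVertices (sampleSize_le _ _ _), hm']
    have hup : (⌊c * (n * L / k)⌋₊ : ℝ) * k / n ≤ c * L := by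
      have := Nat.floor_le (a := c * (n * L / k)) (by positivity)
      calc _ ≤ c * (n * L / k) * k / n := by gcongr
        _ = c * L := by field_simp
    have hlo : c * L - 1 ≤ (⌊c * (n * L / k)⌋₊ : ℝ) * k / n := by
      have := (Nat.sub_one_lt_floor (c * (n * L / k))).le
      calc c * L - 1 ≤ c * L - k / n := by
            gcongr
            exact (div_le_one hn').mpr hkn'
        _ = (c * (n * L / k) - 1) * k / n := by field_simp
        _ ≤ _ := by gcongr
    refine (uniformOn_card_inter_lt_le (by omega) hk hkn.le _ (t := δ * L) (by positivity)
      ?_).trans (ENNReal.ofReal_le_ofReal ?_)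
    · rw [hcard]
      nlinarith
    · rw [hcard]
      calc _ ≤ c * L / (δ * L) ^ 2 := by gcongr
        _ = _ := by field_simp

theorem tendsto_successProb_cliqueFinder {ε ε₀ : ℝ} (hε : 0 < ε) (hε₀ : 0 < ε₀) (k : ℕ → ℕ)
    (hk : ∀ᶠ n in atTop, 1 ≤ k n ∧ k n < n ∧ (2 + ε) * Real.logb 2 n ≤ k n) :
    Tendsto (fun n => successProb (k n) (cliqueFinder ε₀ n (k n))) atTop (𝓝 1) := by
  have hc : 2 < √(4 + 2 * ε₀) := by
    rw [Real.lt_sqrt (by norm_num)]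
    linarith
  obtain ⟨δ, hδ, hδε, hδc⟩ : ∃ δ : ℝ, 0 < δ ∧ δ ≤ ε ∧ 2 + 3 * δ ≤ √(4 + 2 * ε₀) := by
    refine ⟨min ε ((√(4 + 2 * ε₀) - 2) / 3), lt_min hε (by linarith), min_le_left _ _, ?_⟩
    have := min_le_right ε ((√(4 + 2 * ε₀) - 2) / 3)
    linarith
  obtain ⟨η, hη, hηε₀, hη1⟩ : ∃ η : ℝ, 0 < η ∧ η ≤ ε₀ ∧ η ≤ 1 :=
    ⟨min ε₀ 1, lt_min hε₀ one_pos, min_le_left _ _, min_le_right _ _⟩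
  obtain ⟨γ, hγ⟩ : ∃ γ : ℝ, γ = 1 / 2 - 1 / (2 + δ) := ⟨_, rfl⟩
  have hγ0 : 0 < γ := by
    rw [hγ, sub_pos]
    exact one_div_lt_one_div_of_lt (by norm_num) (by linarith)
  have hLtop : Tendsto (fun n : ℕ => Real.logb 2 (n : ℝ)) atTop atTop :=
    (Real.tendsto_logb_atTop (by norm_num)).comp tendsto_natCast_atTop_atTop
  have hp : Tendsto (fun n : ℕ => √(4 + 2 * ε₀) / δ ^ 2 * (Real.logb 2 (n : ℝ))⁻¹) atTop
      (𝓝 0) := by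
    simpa using hLtop.inv_tendsto_atTop.const_mul (√(4 + 2 * ε₀) / δ ^ 2)
  have hρ : Tendsto (fun n : ℕ => 8 / γ * (n : ℝ) ^ (-γ)) atTop (𝓝 0) := by
    simpa using ((tendsto_rpow_neg_atTop hγ0).comp tendsto_natCast_atTop_atTop).const_mul (8 / γ)
  have hη' : Tendsto (fun n : ℕ => 2 * (n : ℝ) ^ (-η)) atTop (𝓝 0) := by
    simpa using ((tendsto_rpow_neg_atTop hη).comp tendsto_natCast_atTop_atTop).const_mul 2
  have hr : Tendsto (fun n : ℕ => 2 * (8 / γ * (n : ℝ) ^ (-γ)) + 2 * (n : ℝ) ^ (-η)) atTop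
      (𝓝 0) := by
    simpa using (hρ.const_mul 2).add hη'
  have hlow : Tendsto (fun n : ℕ =>
      1 - (ENNReal.ofReal (√(4 + 2 * ε₀) / δ ^ 2 * (Real.logb 2 (n : ℝ))⁻¹) +
        ENNReal.ofReal (2 * (8 / γ * (n : ℝ) ^ (-γ)) + 2 * (n : ℝ) ^ (-η)))) atTop (𝓝 1) := by
    have h := (ENNReal.tendsto_ofReal hp).add (ENNReal.tendsto_ofReal hr)
    simpa using ENNReal.Tendsto.sub (tendsto_const_nhds (x := (1 : ℝ≥0∞))) h
      (Or.inl ENNReal.one_ne_top)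
  refine tendsto_of_tendsto_of_tendsto_of_le_of_le' hlow tendsto_const_nhds ?_ ?_
  · filter_upwards [hk, hLtop.eventually_ge_atTop (1 / δ),
      hρ.eventually_le_const (show (0 : ℝ) < 1 / 2 by norm_num)] with n hkn hLn hρn
    obtain ⟨hk1, hkn, hkL⟩ := hkn
    have hn : 1 ≤ n := by omega
    have hL : 1 ≤ δ * Real.logb 2 n := by
      rw [div_le_iff₀ hδ] at hLn
      linarith
    have hL0 : 0 < Real.logb 2 n := lt_of_lt_of_le (by positivity) hLn
    refine le_successProb hkn.le _ _ _ _
      (uniformOn_planted_part_lt_le hε₀ hδ hδε hδc hk1 hkn hkL hL) fun K _ hK => ?_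
    rw [Set.mem_ofPred_eq, not_lt] at hK
    have hpos : 1 ≤ (K ∩ initialVertices n (sampleSize ε₀ n (k n))).card := by
      rw [Nat.one_le_iff_ne_zero]
      intro h0
      rw [h0, Nat.cast_zero] at hK
      have : 0 < (2 + δ) * Real.logb 2 n := by positivity
      linarith
    have hbound := mul_half_pow_le hn hδ hγ hK
    rw [← ENNReal.ofReal_toReal (measure_ne_top (erdosRenyi n) _)]
    refine ENNReal.ofReal_le_ofReal ?_
    exact (real_erdosRenyi_run_ne_le K _ _ hpos (hbound.trans hρn)).trans
      (add_le_add (mul_le_mul_of_nonneg_left hbound zero_le_two)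
        (mul_half_pow_min_le hn hδ hηε₀ hη1 hK))
  · filter_upwards [hk] with n hkn
    have := isProbabilityMeasure_plantedCliqueModel hkn.2.1.le
    exact prob_le_one

end PlantedClique

theorem theorem2 :
    -- impossibility with `q = o(n² / k² + n)` queries, for randomized algorithms too
    (∀ k q : ℕ → ℕ,
      (∀ᶠ n in atTop, 1 ≤ k n ∧ k n < n) →
      ((fun n => (q n : ℝ)) =o[atTop] fun n => (n : ℝ) ^ 2 / (k n : ℝ) ^ 2 + (n : ℝ)) →
      ∀ R : (n : ℕ) → PMF (PlantedClique.Algorithm n (Finset (Fin n))),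
        (∀ᶠ n in atTop, ∀ A ∈ (R n).support, ∀ G : SimpleGraph (Fin n),
          A.numQueries G ≤ q n) →
        Tendsto (fun n => PlantedClique.randomizedSuccessProb (k n) (R n)) atTop (𝓝 0)) ∧
    -- a deterministic two-round algorithm that finds the planted clique
    (∀ ε : ℝ, 0 < ε → ∀ ε₀ : ℝ, 0 < ε₀ →
      ∃ A : (n k : ℕ) → PlantedClique.Algorithm n (Finset (Fin n)),
        (∀ n k : ℕ, 1 ≤ k → k < n → (2 + ε) * Real.logb 2 n ≤ k →
          PlantedClique.IsCliqueExtension ⌊(1 + ε₀) * Real.logb 2 n⌋₊ (A n k) ∧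
          ∀ G : SimpleGraph (Fin n), ((A n k).numQueries G : ℝ) ≤
            (2 + ε₀) * ((n : ℝ) ^ 2 / (k : ℝ) ^ 2) * (Real.logb 2 n) ^ 2 +
              (1 + ε₀) * n * Real.logb 2 n) ∧
        ∀ k : ℕ → ℕ,
          (∀ᶠ n in atTop, 1 ≤ k n ∧ k n < n ∧ (2 + ε) * Real.logb 2 n ≤ k n) →
          Tendsto (fun n => PlantedClique.successProb (k n) (A n (k n))) atTop (𝓝 1)) := by
  refine ⟨PlantedClique.tendsto_randomizedSuccessProb, fun ε hε ε₀ hε₀ =>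
    ⟨PlantedClique.cliqueFinder ε₀, fun n k hk hkn _ =>
      ⟨PlantedClique.isCliqueExtension_cliqueExtension _ _,
        PlantedClique.numQueries_cliqueFinder_le hε₀ hk hkn⟩,
      PlantedClique.tendsto_successProb_cliqueFinder hε hε₀⟩⟩
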